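/- **Setting.** *Wavelets.* For $g:\mathbb R\to\mathbb R$ and $j,k\in\mathbb Z$ write $g_{jk}(x)=2^{j/2}g(2^jx-k)$. Let $s>0$, $p,q\in[1,\infty]$ and $r\in[1,\infty)$. Let $\varphi\in L^2(\mathbb R)$ be a real father wavelet: $(\varphi_{0k})_{k\in\mathbb Z}$ is orthonormal and the closed spans $V_j$ of $(\varphi_{jk})_{k\in\mathbb Z}$ are nested, $V_j\subseteq V_{j+1}$, with dense union in $L^2(\mathbb R)$. Assume that for some integer $N\ge 0$ with $s<N+1$ the function $\varphi$ has a weak derivative $\varphi^{(N+1)}$ of order $N+1$ with $\operatorname{ess\,sup}_x\sum_{k\in\mathbb Z}|\varphi^{(N+1)}(x-k)|<\infty$, and that there is a bounded non-increasing function $\Phi$ on $[0,\infty)$ with $|\varphi(u)|\le\Phi(|u|)$, $\int\Phi(|u|)\,du<\infty$ and $\int\Phi(|u|)|u|^N\,du<\infty$. Let $\psi\in L^2(\mathbb R)$ be a compactly supported real mother wavelet associated with $\varphi$, that is, $(\psi_{0k})_{k\in\mathbb Z}$ is an orthonormal basis of the orthogonal complement of $V_0$ in $V_1$. *Densities.*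 For $f\in L^1(\mathbb R)$ put $\alpha_{0k}=\int f\varphi_{0k}$, $\beta_{jk}=\int f\psi_{jk}$ and $$J_{spq}(f)=\|\alpha_{0\cdot}\|_{\ell^p}+\Big(\sum_{j\ge0}\big(2^{j(s+1/2-1/p)}\|\beta_{j\cdot}\|_{\ell^p}\big)^q\Big)^{1/q}\in[0,\infty]$$ (with the usual modification if $q=\infty$). For $L,T>0$ let $\mathcal D^s_{pq}(L,T)$ be the set of probability densities $f$ on $\mathbb R$ with $\operatorname{supp} f\subseteq[-T,T]$ and $J_{spq}(f)\le L$. *Privacy.* Let $\alpha>0$ and $n\in\mathbb N$. Given independent $X_1,\dots,X_n$ with density $f$, a channel with values in a measurable space $\mathcal Z$ releases successively $Z_i\sim Q_i(\,\cdot\mid X_i,Z_1,\dots,Z_{i-1})$, $i=1,\dots,n$, where the $Q_i$ are Markov kernels. It is locally $\alpha$-differentially private, $Q\in\mathcal Q_\alpha$, if $Q_i(A\mid x,z_1,\dots,z_{i-1})\le e^{\alpha}Q_i(A\mid x',z_1,\dots,z_{i-1})$ for all $i$, all measurable $A$, all $x,x'\in\mathbb R$ and all $z_1,\dots,z_{i-1}\in\mathcal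 Z$. An estimator $\widetilde f$ is a function of $(Z_1,\dots,Z_n)$ with values in the functions on $\mathbb R$, jointly measurable in $(z,x)\in\mathcal Z^n\times\mathbb R$. **Proposition 2.1.** Let $L,T>0$ be such that $\mathcal D^s_{pq}(L',T)\ne\emptyset$ for some $L'<L$. Then there is a constant $C>0$, not depending on $n$ and $\alpha$, such that for all $\alpha>0$ and all $n\in\mathbb N$ with $n(e^\alpha-1)^2\ge1$, $$\inf_{\widetilde f,\;Q\in\mathcal Q_\alpha}\ \sup_{f\in\mathcal D^s_{pq}(L,T)}\mathbb E_{f,Q}\|\widetilde f-f\|_r^r\ \ge\ C\,\big(n(e^\alpha-1)^2\big)^{-\frac{rs}{2s+2}},$$ where the infimum is over all measurable spaces $\mathcal Z$, all locally $\alpha$-differentially private channels $Q$ with values in $\mathcal Z$ and all estimators $\widetilde f$ based on the private views $Z_1,\dots,Z_n$. In particular, for every fixed $\alpha>0$ the bound holds for all sufficiently large $n$. -/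

import Mathlib

open MeasureTheory ProbabilityTheory
open scoped ENNReal NNReal ContDiff

universe u

noncomputable section

/-! ### Wavelets on the real line -/

/-- The dyadic dilation and translation `x ↦ 2^{j/2} g(2^j x - k)`. -/
def dyadic (g : ℝ → ℝ) (j k : ℤ) (x : ℝ) : ℝ :=
  (2 : ℝ) ^ ((j : ℝ) / 2) * g ((2 : ℝ) ^ j * x - k)

theorem memLp_dyadic {g : ℝ → ℝ} (hg : MemLp g 2 volume) (j k : ℤ) :
    MemLp (dyadic g j k) 2 volume := by
  have h2 : (2 : ℝ) ^ j ≠ 0 := zpow_ne_zero _ two_ne_zero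
  have h1 : MemLp (fun y : ℝ => g (y - k)) 2 volume :=
    hg.comp_measurePreserving (measurePreserving_sub_right volume (k : ℝ))
  have h3 : MemLp (fun y : ℝ => g (y - k)) 2 (Measure.map ((2 : ℝ) ^ j * ·) volume) := by
    rw [Real.map_volume_mul_left h2]
    exact h1.smul_measure ENNReal.ofReal_ne_top
  exact (h3.comp_of_map (by fun_prop)).const_mul _

/-- The function `2^{j/2} g(2^j · - k)` as an element of `L²(ℝ)`. -/
def dyadicL2 (g : ℝ → ℝ) (hg : MemLp g 2 volume) (j k : ℤ) : Lp ℝ 2 (volume : Measure ℝ) :=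
  (memLp_dyadic hg j k).toLp (dyadic g j k)

/-- The closed linear span in `L²(ℝ)` of the functions `2^{j/2} g(2^j · - k)`, `k ∈ ℤ`. -/
def levelSpace (g : ℝ → ℝ) (hg : MemLp g 2 volume) (j : ℤ) :
    Submodule ℝ (Lp ℝ 2 (volume : Measure ℝ)) :=
  (Submodule.span ℝ (Set.range (dyadicL2 g hg j))).topologicalClosure

/-- `φ` is a father wavelet: it generates a multiresolution analysis of `L²(ℝ)`. (That the
spaces `V_j` intersect in `{0}` is a consequence and need not be required.) -/
structure GeneratesMRA (φ : ℝ → ℝ) (hφ : MemLp φ 2 volume) : Prop where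
  orthonormal : Orthonormal ℝ (dyadicL2 φ hφ 0)
  nested : ∀ j : ℤ, levelSpace φ hφ j ≤ levelSpace φ hφ (j + 1)
  dense : (⨆ j : ℤ, levelSpace φ hφ j).topologicalClosure = ⊤

/-- `ψ` is a mother wavelet associated to the father wavelet `φ`: its integer translates are an
orthonormal basis of the orthogonal complement `W_0` of `V_0` in `V_1`. -/
structure IsMotherWavelet (φ ψ : ℝ → ℝ) (hφ : MemLp φ 2 volume) (hψ : MemLp ψ 2 volume) :
    Prop where
  orthonormal : Orthonormal ℝ (dyadicL2 ψ hψ 0)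
  span_eq : levelSpace ψ hψ 0 = levelSpace φ hφ 1 ⊓ (levelSpace φ hφ 0)ᗮ

/-- `g` is the weak derivative of order `m` of `f` on `ℝ`. -/
def HasWeakDerivOfOrder (m : ℕ) (f g : ℝ → ℝ) : Prop :=
  LocallyIntegrable f volume ∧ LocallyIntegrable g volume ∧
    ∀ η : ℝ → ℝ, ContDiff ℝ ∞ η → HasCompactSupport η →
      ∫ x, f x * iteratedDeriv m η x = (-1) ^ m * ∫ x, g x * η x

/-- The regularity and decay assumption of order `N` on the father wavelet. -/
structure FatherRegular (φ : ℝ → ℝ) (N : ℕ) : Prop where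
  weakDeriv : ∃ g : ℝ → ℝ, HasWeakDerivOfOrder (N + 1) φ g ∧
    ∃ B : ℝ≥0, ∀ᵐ x : ℝ, ∑' k : ℤ, ‖g (x - k)‖ₑ ≤ B
  decay : ∃ Φ : ℝ → ℝ, AntitoneOn Φ (Set.Ici 0) ∧ (∃ B : ℝ, ∀ u, 0 ≤ u → Φ u ≤ B) ∧
    (∀ u, |φ u| ≤ Φ |u|) ∧ Integrable (fun u : ℝ => Φ |u|) ∧
    Integrable (fun u : ℝ => Φ |u| * |u| ^ N)

/-! ### Besov classes of densities -/

/-- The wavelet coefficient `∫ f(x) 2^{j/2} g(2^j x - k) dx`. -/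
def waveletCoeff (g f : ℝ → ℝ) (j k : ℤ) : ℝ := ∫ x, f x * dyadic g j k x

/-- The Besov sequence norm
`J_{spq}(f) = ‖α_{0·}‖_p + (∑_{j ≥ 0} (2^{j(s+1/2-1/p)} ‖β_{j·}‖_p)^q)^{1/q}`, with the usual
modifications for infinite `p` or `q`: `eLpNorm` with respect to the counting measure is the
`ℓ^p`-norm, with the value `∞` for sequences outside `ℓ^p`, and `p.toReal⁻¹ = 0` for `p = ∞`. -/
def besovNorm (φ ψ : ℝ → ℝ) (s : ℝ) (p q : ℝ≥0∞) (f : ℝ → ℝ) : ℝ≥0∞ :=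
  eLpNorm (fun k : ℤ => waveletCoeff φ f 0 k) p Measure.count +
    eLpNorm (fun j : ℕ => ENNReal.ofReal ((2 : ℝ) ^ ((j : ℝ) * (s + 1 / 2 - p.toReal⁻¹))) *
      eLpNorm (fun k : ℤ => waveletCoeff ψ f j k) p Measure.count) q Measure.count

/-- The probability densities supported in `[-T, T]` with Besov norm at most `L`. -/
def densityBesov (φ ψ : ℝ → ℝ) (s : ℝ) (p q : ℝ≥0∞) (L T : ℝ) : Set (ℝ → ℝ) :=
  {f | Integrable f ∧ (∀ x, 0 ≤ f x) ∧ ∫ x, f x = 1 ∧ tsupport f ⊆ Set.Icc (-T) T ∧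
    besovNorm φ ψ s p q f ≤ ENNReal.ofReal L}

/-! ### Local differential privacy -/

/-- A (sequentially interactive) privacy channel with values in `Z`: data holder number `i`, counted
from `0`, draws `Z_i` from `Q i (x, (z_0, …, z_{i-1}))`, where `x` is the observation of
this data holder and `z_0, …, z_{i-1}` are the private views released before. -/
abbrev Channel (Z : Type u) [MeasurableSpace Z] : Type u :=
  (i : ℕ) → Kernel (ℝ × (Fin i → Z)) Z

/-- The kernels of the first `n` data holders are Markov kernels and provide local
`α`-differential privacy. -/
def IsLocallyPrivate {Z : Type u} [MeasurableSpace Z] (α : ℝ) (n : ℕ) (Q : Channel Z) : Prop :=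
  ∀ i < n, IsMarkovKernel (Q i) ∧
    ∀ (z : Fin i → Z) (x x' : ℝ) (A : Set Z), MeasurableSet A →
      Q i (x, z) A ≤ ENNReal.ofReal (Real.exp α) * Q i (x', z) A

/-- The law of the private sample `(Z_0, …, Z_{n-1})` when the observations are independent with
law `P`: given the first `n` private views `z`, the next data holder has an observation `x` with
law `P`, independent of `z`, and releases a draw `z'` from `Q n (x, z)`. -/
def privateLaw {Z : Type u} [MeasurableSpace Z] (P : Measure ℝ) (Q : Channel Z) :
    (n : ℕ) → Measure (Fin n → Z)
  | 0 => Measure.dirac (fun i => i.elim0)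
  | n + 1 => ((P.prod (privateLaw P Q n)) ⊗ₘ Q n).map
      (fun w : (ℝ × (Fin n → Z)) × Z => (Fin.snoc w.1.2 w.2 : Fin (n + 1) → Z))

/-- The probability measure on `ℝ` with density `f`. -/
def densityLaw (f : ℝ → ℝ) : Measure ℝ := volume.withDensity (fun x => ENNReal.ofReal (f x))

/-- The loss `‖f - g‖_r^r = ∫ |f(x) - g(x)|^r dx`, possibly infinite. -/
def lrLoss (r : ℝ) (f g : ℝ → ℝ) : ℝ≥0∞ := ∫⁻ x, ENNReal.ofReal (|f x - g x| ^ r)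

/-- The local `α`-differentially private minimax risk over the class `F` for the `L^r`-loss: the
infimum over all spaces `Z` of private views, all locally `α`-differentially private channels `Q`
and all estimators `fhat` based on the private views, of the maximal risk over `F`. -/
def privateMinimaxRisk (α : ℝ) (n : ℕ) (r : ℝ) (F : Set (ℝ → ℝ)) : ℝ≥0∞ :=
  ⨅ (Z : Type u) (_ : MeasurableSpace Z) (Q : Channel Z) (_ : IsLocallyPrivate α n Q)
    (fhat : (Fin n → Z) → ℝ → ℝ) (_ : Measurable (Function.uncurry fhat)),
    ⨆ f ∈ F, ∫⁻ z, lrLoss r (fhat z) f ∂(privateLaw (densityLaw f) Q n)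

end

/-! By local privacy, the conditional densities of each private view vary in the observation by a
factor of at most `e^α`; hence if the densities `f` and `f'` of the observations have
`L¹`-distance `d`, the laws of one private view have `χ²`-divergence of order `(e^α - 1)² d²`, and
the divergences of successive views combine multiplicatively. By Assouad's lemma, the risk over a
hypercube of densities is then at least of the order of the sum of the `L^r`-norms, raised to the
power `r`, of the perturbations in the individual directions, as long as `n (e^α - 1)² d²` stays
bounded for neighbouring vertices.

The hypercube consists of the perturbations `b + ∑ ± γ ψ_{jk}` of a density `b` by about `2^j`
wavelets with disjoint supports and with sup norm of order `2^{-js}`, the largest one that the Besov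
norm allows. Neighbours are at `L¹`-distance of order `2^{-j(s+1)}`, so the level is
`2^j ≈ (n (e^α - 1)²)^{1/(2s+2)}`, and the loss is of order `2^{-jrs}`.

The density `b` must lie in the interior of the class. It is a mixture of a given density with
`J < L` and of a smooth bump, whose Besov norm is finite because `ψ` has `N + 1` vanishing moments.
These come from regularity: the bound on the weak derivative passes from `φ` to `ψ`, and if the
moments of order less than `l ≤ N` vanish but the one of order `l` does not, then pairing `ψ`
with its dilates, to which it is orthogonal, shows that its derivative of order `l` vanishes at all
dyadic points, so that `ψ = 0`. -/

noncomputable section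

/-- `f` is a probability density on the real line. -/
structure IsDensity (f : ℝ → ℝ) : Prop where
  integrable : Integrable f
  nonneg : ∀ x, 0 ≤ f x
  integral_eq_one : ∫ x, f x = 1

theorem IsDensity.isProbabilityMeasure {f : ℝ → ℝ} (hf : IsDensity f) :
    IsProbabilityMeasure (densityLaw f) := by
  constructor
  rw [densityLaw, withDensity_apply _ MeasurableSet.univ, Measure.restrict_univ,
    ← ofReal_integral_eq_lintegral_ofReal hf.integrable (.of_forall hf.nonneg),
    hf.integral_eq_one, ENNReal.ofReal_one]

theorem IsDensity.integral_sub_eq_zero {f f' : ℝ → ℝ} (hf : IsDensity f) (hf' : IsDensity f') :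
    ∫ x, (f x - f' x) = 0 := by
  rw [integral_sub hf.integrable hf'.integrable, hf.integral_eq_one, hf'.integral_eq_one, sub_self]

/-- The bound `χ²(μ ‖ ν) ≤ K - 1` on the `χ²`-divergence, in the dual form: among the `g` with
`∫ g² dν = 1`, the largest value of `(∫ g dμ)²` is `1 + χ²(μ ‖ ν)`. -/
def ChiSqBound {X : Type*} [MeasurableSpace X] (K : ℝ≥0∞) (μ ν : Measure X) : Prop :=
  ∀ ⦃g : X → ℝ≥0∞⦄, Measurable g → (∫⁻ x, g x ∂μ) ^ 2 ≤ K * ∫⁻ x, g x ^ 2 ∂ν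

section ChiSq

variable {X : Type*} [MeasurableSpace X] {μ ν : Measure X}

theorem chiSqBound_of_lintegral_rnDeriv_sq_le [SigmaFinite μ] [SigmaFinite ν] (hμν : μ ≪ ν)
    {K : ℝ≥0∞} (hK : ∫⁻ x, μ.rnDeriv ν x ^ 2 ∂ν ≤ K) : ChiSqBound K μ ν := by
  intro g hg
  have cauchy_schwarz := ENNReal.lintegral_mul_le_Lp_mul_Lq ν Real.HolderConjugate.two_two
    (Measure.measurable_rnDeriv μ ν).aemeasurable hg.aemeasurable
  have change_of_measure : ∫⁻ x, (μ.rnDeriv ν * g) x ∂ν = ∫⁻ x, g x ∂μ :=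
    lintegral_rnDeriv_mul hμν hg.aemeasurable
  rw [change_of_measure] at cauchy_schwarz
  calc (∫⁻ x, g x ∂μ) ^ 2
      ≤ ((∫⁻ x, μ.rnDeriv ν x ^ (2 : ℝ) ∂ν) ^ (1 / (2 : ℝ)) *
        (∫⁻ x, g x ^ (2 : ℝ) ∂ν) ^ (1 / (2 : ℝ))) ^ 2 := by gcongr
    _ = (∫⁻ x, μ.rnDeriv ν x ^ 2 ∂ν) * ∫⁻ x, g x ^ 2 ∂ν := by
        rw [mul_pow, ← ENNReal.rpow_natCast, ← ENNReal.rpow_mul, ← ENNReal.rpow_natCast,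
          ← ENNReal.rpow_mul]
        norm_num
    _ ≤ K * ∫⁻ x, g x ^ 2 ∂ν := by gcongr

theorem absolutelyContinuous_of_forall_measure_le {C : ℝ≥0∞}
    (h : ∀ A, MeasurableSet A → μ A ≤ C * ν A) : μ ≪ ν :=
  .mk fun A hA hA0 => by simpa [hA0] using h A hA

theorem rnDeriv_pinched [SigmaFinite μ] [SigmaFinite ν] {δ : ℝ≥0∞}
    (hle : ∀ A, MeasurableSet A → μ A ≤ (1 + δ) * ν A)
    (hge : ∀ A, MeasurableSet A → ν A ≤ μ A + δ * ν A) :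
    ∀ᵐ x ∂ν, μ.rnDeriv ν x ≤ 1 + δ ∧ 1 ≤ μ.rnDeriv ν x + δ := by
  have hμν : μ ≪ ν := absolutelyContinuous_of_forall_measure_le hle
  have hset : ∀ A, MeasurableSet A → ∫⁻ x in A, μ.rnDeriv ν x ∂ν = μ A := fun A hA =>
    Measure.setLIntegral_rnDeriv' hμν hA
  refine Filter.Eventually.and ?_ ?_
  · refine ae_le_of_forall_setLIntegral_le_of_sigmaFinite (Measure.measurable_rnDeriv μ ν)
      fun A hA _ => ?_
    rw [hset A hA, setLIntegral_const]
    exact hle A hA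
  · refine ae_le_of_forall_setLIntegral_le_of_sigmaFinite measurable_const fun A hA _ => ?_
    rw [lintegral_add_right _ measurable_const, hset A hA, setLIntegral_const, setLIntegral_const,
      one_mul]
    exact hge A hA

theorem sq_add_one_le_of_pinched {t : ℝ≥0∞} {δ : ℝ≥0} (hle : t ≤ 1 + δ) (hge : 1 ≤ t + δ) :
    t ^ 2 + 1 ≤ 2 * t + (δ : ℝ≥0∞) ^ 2 := by
  lift t to ℝ≥0 using ne_top_of_le_ne_top (by finiteness) hle
  norm_cast at hle hge ⊢
  have hle' : (t : ℝ) ≤ 1 + δ := mod_cast hle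
  have hge' : (1 : ℝ) ≤ t + δ := mod_cast hge
  have : (t : ℝ) ^ 2 + 1 ≤ 2 * t + δ ^ 2 := by nlinarith [hle', hge']
  exact mod_cast this

theorem chiSqBound_of_setwise_pinched [IsProbabilityMeasure μ] [IsProbabilityMeasure ν] {δ : ℝ≥0}
    (hle : ∀ A, MeasurableSet A → μ A ≤ (1 + δ) * ν A)
    (hge : ∀ A, MeasurableSet A → ν A ≤ μ A + δ * ν A) :
    ChiSqBound (1 + (δ : ℝ≥0∞) ^ 2) μ ν := by
  have hμν : μ ≪ ν := absolutelyContinuous_of_forall_measure_le hle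
  refine chiSqBound_of_lintegral_rnDeriv_sq_le hμν ?_
  have hint : ∫⁻ x, (μ.rnDeriv ν x ^ 2 + 1) ∂ν
      ≤ ∫⁻ x, (2 * μ.rnDeriv ν x + (δ : ℝ≥0∞) ^ 2) ∂ν :=
    lintegral_mono_ae <| (rnDeriv_pinched hle hge).mono fun x hx =>
      sq_add_one_le_of_pinched hx.1 hx.2
  rw [lintegral_add_right _ measurable_const, lintegral_add_right _ measurable_const,
    lintegral_const_mul _ (Measure.measurable_rnDeriv μ ν), Measure.lintegral_rnDeriv hμν,
    lintegral_const, lintegral_const, measure_univ, measure_univ, mul_one, mul_one, mul_one] at hint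
  refine (ENNReal.add_le_add_iff_right ENNReal.one_ne_top).1 (hint.trans_eq ?_)
  ring

end ChiSq

/-! ### Local privacy contracts the `χ²`-divergence -/

theorem abs_integral_mul_le_of_mem_Icc {X : Type*} [MeasurableSpace X] {μ : Measure X}
    {κ h : X → ℝ} {m M : ℝ} (hκ : AEStronglyMeasurable κ μ) (hκm : ∀ x, κ x ∈ Set.Icc m M)
    (hh : Integrable h μ) (hh0 : ∫ x, h x ∂μ = 0) :
    |∫ x, κ x * h x ∂μ| ≤ (M - m) * ∫ x, |h x| ∂μ := by
  have hbound : ∀ x, |κ x - m| ≤ M - m := fun x => by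
    rw [abs_of_nonneg (sub_nonneg.2 (hκm x).1)]
    linarith [(hκm x).2]
  have hint : Integrable (fun x => (κ x - m) * h x) μ :=
    hh.bdd_mul (hκ.sub aestronglyMeasurable_const) (.of_forall hbound)
  have hshift : ∫ x, κ x * h x ∂μ = ∫ x, (κ x - m) * h x ∂μ := by
    have : ∀ x, κ x * h x = (κ x - m) * h x + m * h x := fun x => by ring
    simp_rw [this]
    rw [integral_add hint (hh.const_mul m), integral_const_mul, hh0, mul_zero, add_zero]
  calc |∫ x, κ x * h x ∂μ| = |∫ x, (κ x - m) * h x ∂μ| := by rw [hshift]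
    _ ≤ ∫ x, |(κ x - m) * h x| ∂μ := abs_integral_le_integral_abs
    _ ≤ ∫ x, (M - m) * |h x| ∂μ := by
        refine integral_mono hint.abs (hh.abs.const_mul _) fun x => ?_
        simpa only [abs_mul] using mul_le_mul_of_nonneg_right (hbound x) (abs_nonneg (h x))
    _ = (M - m) * ∫ x, |h x| ∂μ := integral_const_mul _ _

theorem abs_integral_mul_sub_le_of_ratio_le {f f' κ : ℝ → ℝ} {C : ℝ} (hC : 1 ≤ C)
    (hf : IsDensity f) (hf' : IsDensity f') (hκ : Measurable κ) (hκ0 : ∀ x, 0 ≤ κ x)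
    (hratio : ∀ x x', κ x ≤ C * κ x') :
    |(∫ x, κ x * f x) - ∫ x, κ x * f' x| ≤
      (C - 1) * (∫ x, |f x - f' x|) * ∫ x, κ x * f' x := by
  set m := ⨅ x, κ x
  have hm : ∀ x, m ≤ κ x := ciInf_le ⟨0, by rintro _ ⟨x, rfl⟩; exact hκ0 x⟩
  have hM : ∀ x, κ x ≤ C * m := fun x => by
    rw [← div_le_iff₀' (by linarith)]
    exact le_ciInf fun x' => by rw [div_le_iff₀' (by linarith)]; exact hratio x x'
  have hint : ∀ {h : ℝ → ℝ}, Integrable h → Integrable (fun x => κ x * h x) := fun hh =>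
    hh.bdd_mul (c := C * m) hκ.aestronglyMeasurable
      (.of_forall fun x => by simpa [abs_of_nonneg (hκ0 x)] using hM x)
  have hm_le : m ≤ ∫ x, κ x * f' x :=
    calc m = ∫ x, m * f' x := by rw [integral_const_mul, hf'.integral_eq_one, mul_one]
      _ ≤ ∫ x, κ x * f' x := integral_mono (hf'.integrable.const_mul m) (hint hf'.integrable)
          fun x => mul_le_mul_of_nonneg_right (hm x) (hf'.nonneg x)
  calc |(∫ x, κ x * f x) - ∫ x, κ x * f' x| = |∫ x, κ x * (f x - f' x)| := by
        rw [← integral_sub (hint hf.integrable) (hint hf'.integrable)]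
        simp_rw [mul_sub]
    _ ≤ (C * m - m) * ∫ x, |f x - f' x| :=
        abs_integral_mul_le_of_mem_Icc hκ.aestronglyMeasurable (fun x => ⟨hm x, hM x⟩)
          (hf.integrable.sub hf'.integrable) (hf.integral_sub_eq_zero hf')
    _ = (C - 1) * (∫ x, |f x - f' x|) * m := by ring
    _ ≤ (C - 1) * (∫ x, |f x - f' x|) * ∫ x, κ x * f' x := by
        refine mul_le_mul_of_nonneg_left hm_le (mul_nonneg (by linarith) ?_)
        exact integral_nonneg fun x => abs_nonneg _

/-- The conditional law of a private view drawn from `κ (X, y)`, where `X` has law `P` and `y` is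
the value of the earlier views. -/
def viewLaw {X Y Z : Type*} [MeasurableSpace X] [MeasurableSpace Y] [MeasurableSpace Z]
    (P : Measure X) (κ : Kernel (X × Y) Z) (y : Y) : Measure Z :=
  P.bind fun x => κ (x, y)

section ViewLaw

variable {X Y Z : Type*} [MeasurableSpace X] [MeasurableSpace Y] [MeasurableSpace Z]
  (P : Measure X) (κ : Kernel (X × Y) Z) (y : Y)

theorem measurable_kernel_prodMk_right : Measurable fun x : X => κ (x, y) :=
  κ.measurable.comp measurable_prodMk_right

theorem viewLaw_apply {A : Set Z} (hA : MeasurableSet A) :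
    viewLaw P κ y A = ∫⁻ x, κ (x, y) A ∂P :=
  Measure.bind_apply hA (measurable_kernel_prodMk_right κ y).aemeasurable

theorem lintegral_viewLaw {g : Z → ℝ≥0∞} (hg : Measurable g) :
    ∫⁻ z, g z ∂viewLaw P κ y = ∫⁻ x, ∫⁻ z, g z ∂κ (x, y) ∂P :=
  Measure.lintegral_bind (measurable_kernel_prodMk_right κ y).aemeasurable hg.aemeasurable

instance isProbabilityMeasure_viewLaw [IsProbabilityMeasure P] [IsMarkovKernel κ] :
    IsProbabilityMeasure (viewLaw P κ y) := by
  constructor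
  rw [viewLaw_apply P κ y MeasurableSet.univ]
  simp

end ViewLaw

section ViewLawDensity

variable {Y Z : Type*} [MeasurableSpace Y] [MeasurableSpace Z] (κ : Kernel (ℝ × Y) Z)
  (y : Y) {A : Set Z} {f f' : ℝ → ℝ}

theorem measurable_kernel_real (hA : MeasurableSet A) :
    Measurable fun x : ℝ => (κ (x, y)).real A :=
  ((κ.measurable_coe hA).comp measurable_prodMk_right).ennreal_toReal

variable [IsMarkovKernel κ]

theorem viewLaw_densityLaw_apply (hf : IsDensity f) (hA : MeasurableSet A) :
    viewLaw (densityLaw f) κ y A = ENNReal.ofReal (∫ x, (κ (x, y)).real A * f x) := by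
  have hint : Integrable fun x => (κ (x, y)).real A * f x :=
    hf.integrable.bdd_mul (c := 1) (measurable_kernel_real κ y hA).aestronglyMeasurable
      (.of_forall fun x => by
        simpa only [Real.norm_of_nonneg measureReal_nonneg] using measureReal_le_one)
  have hmeas : Measurable fun x : ℝ => κ (x, y) A :=
    (κ.measurable_coe hA).comp measurable_prodMk_right
  rw [viewLaw_apply _ _ _ hA, densityLaw, lintegral_withDensity_eq_lintegral_mul₀
    hf.integrable.aestronglyMeasurable.aemeasurable.ennreal_ofReal hmeas.aemeasurable,
    ofReal_integral_eq_lintegral_ofReal hint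
      (.of_forall fun x => mul_nonneg measureReal_nonneg (hf.nonneg x))]
  refine lintegral_congr fun x => ?_
  rw [Pi.mul_apply, mul_comm, ENNReal.ofReal_mul measureReal_nonneg, ofReal_measureReal]

theorem abs_viewLaw_sub_le {α : ℝ} (hα : 0 ≤ α) (hf : IsDensity f) (hf' : IsDensity f')
    (hκ : ∀ x x', κ (x, y) A ≤ ENNReal.ofReal (Real.exp α) * κ (x', y) A)
    (hA : MeasurableSet A) :
    |(∫ x, (κ (x, y)).real A * f x) - ∫ x, (κ (x, y)).real A * f' x| ≤
      (Real.exp α - 1) * (∫ x, |f x - f' x|) * ∫ x, (κ (x, y)).real A * f' x := by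
  refine abs_integral_mul_sub_le_of_ratio_le (Real.one_le_exp hα) hf hf'
    (measurable_kernel_real κ y hA) (fun x => measureReal_nonneg) fun x x' => ?_
  have := ENNReal.toReal_mono (by finiteness) (hκ x x')
  rwa [ENNReal.toReal_mul, ENNReal.toReal_ofReal (Real.exp_pos _).le] at this

theorem chiSqBound_viewLaw {α : ℝ} (hα : 0 ≤ α) (hf : IsDensity f) (hf' : IsDensity f')
    (hκ : ∀ x x' A, MeasurableSet A → κ (x, y) A ≤ ENNReal.ofReal (Real.exp α) * κ (x', y) A)
    {δ : ℝ≥0} (hδ : (Real.exp α - 1) * (∫ x, |f x - f' x|) ≤ δ) :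
    ChiSqBound (1 + (δ : ℝ≥0∞) ^ 2) (viewLaw (densityLaw f) κ y)
      (viewLaw (densityLaw f') κ y) := by
  have := hf.isProbabilityMeasure
  have := hf'.isProbabilityMeasure
  have hnonneg : ∀ {g : ℝ → ℝ}, IsDensity g → ∀ A, 0 ≤ ∫ x, (κ (x, y)).real A * g x :=
    fun hg A => integral_nonneg fun x => mul_nonneg measureReal_nonneg (hg.nonneg x)
  have hclose : ∀ A, MeasurableSet A →
      |(∫ x, (κ (x, y)).real A * f x) - ∫ x, (κ (x, y)).real A * f' x| ≤
        δ * ∫ x, (κ (x, y)).real A * f' x := fun A hA =>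
    (abs_viewLaw_sub_le κ y hα hf hf' (fun x x' => hκ x x' A hA) hA).trans
      (mul_le_mul_of_nonneg_right hδ (hnonneg hf' A))
  have hδ_coe : (δ : ℝ≥0∞) = ENNReal.ofReal δ := (ENNReal.ofReal_coe_nnreal).symm
  refine chiSqBound_of_setwise_pinched (fun A hA => ?_) (fun A hA => ?_)
  · rw [viewLaw_densityLaw_apply κ y hf hA, viewLaw_densityLaw_apply κ y hf' hA, hδ_coe,
      ← ENNReal.ofReal_one, ← ENNReal.ofReal_add zero_le_one δ.coe_nonneg,
      ← ENNReal.ofReal_mul (by positivity)]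
    exact ENNReal.ofReal_le_ofReal (by linarith [(abs_le.1 (hclose A hA)).2])
  · rw [viewLaw_densityLaw_apply κ y hf hA, viewLaw_densityLaw_apply κ y hf' hA, hδ_coe,
      ← ENNReal.ofReal_mul δ.coe_nonneg,
      ← ENNReal.ofReal_add (hnonneg hf A) (mul_nonneg δ.coe_nonneg (hnonneg hf' A))]
    exact ENNReal.ofReal_le_ofReal (by linarith [(abs_le.1 (hclose A hA)).1])

end ViewLawDensity

section PrivateLaw

variable {Z : Type u} [MeasurableSpace Z]

theorem measurable_fin_snoc (n : ℕ) :
    Measurable fun w : (Fin n → Z) × Z => (Fin.snoc w.1 w.2 : Fin (n + 1) → Z) := by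
  refine measurable_pi_iff.2 fun i => ?_
  refine Fin.lastCases ?_ (fun j => ?_) i
  · simpa only [Fin.snoc_last] using measurable_snd
  · simpa only [Fin.snoc_castSucc, Function.comp_def] using
      (measurable_pi_apply j).comp measurable_fst

theorem measurable_appendView (n : ℕ) :
    Measurable fun w : (ℝ × (Fin n → Z)) × Z => (Fin.snoc w.1.2 w.2 : Fin (n + 1) → Z) :=
  (measurable_fin_snoc n).comp ((measurable_snd.comp measurable_fst).prodMk measurable_snd)

theorem isProbabilityMeasure_privateLaw (P : Measure ℝ) [IsProbabilityMeasure P]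
    {Q : Channel Z} {n : ℕ} (hQ : ∀ i < n, IsMarkovKernel (Q i)) :
    IsProbabilityMeasure (privateLaw P Q n) := by
  induction n with
  | zero => rw [privateLaw]; infer_instance
  | succ n ih =>
    have := ih fun i hi => hQ i (hi.trans n.lt_succ_self)
    have := hQ n n.lt_succ_self
    rw [privateLaw]
    exact Measure.isProbabilityMeasure_map (measurable_appendView n).aemeasurable

section

variable (P : Measure ℝ) {Q : Channel Z} {n : ℕ} {g : (Fin (n + 1) → Z) → ℝ≥0∞}

theorem lintegral_viewLaw_snoc (hg : Measurable g) (z : Fin n → Z) :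
    ∫⁻ w, g (Fin.snoc z w) ∂viewLaw P (Q n) z =
      ∫⁻ x, ∫⁻ w, g (Fin.snoc z w) ∂Q n (x, z) ∂P :=
  lintegral_viewLaw P (Q n) z (hg.comp ((measurable_fin_snoc n).comp measurable_prodMk_left))

theorem measurable_lintegral_channel [IsMarkovKernel (Q n)] (hg : Measurable g) :
    Measurable fun a : ℝ × (Fin n → Z) => ∫⁻ w, g (Fin.snoc a.2 w) ∂Q n a :=
  Measurable.lintegral_kernel_prod_right (f := fun (a : ℝ × (Fin n → Z)) w => g (Fin.snoc a.2 w))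
    (hg.comp (measurable_appendView n))

variable [IsProbabilityMeasure P]

theorem lintegral_privateLaw_succ (hQ : ∀ i < n + 1, IsMarkovKernel (Q i)) (hg : Measurable g) :
    ∫⁻ z, g z ∂privateLaw P Q (n + 1) =
      ∫⁻ z, ∫⁻ w, g (Fin.snoc z w) ∂viewLaw P (Q n) z ∂privateLaw P Q n := by
  have := isProbabilityMeasure_privateLaw P fun i hi => hQ i (hi.trans n.lt_succ_self)
  have := hQ n n.lt_succ_self
  have hg' : Measurable fun w : (ℝ × (Fin n → Z)) × Z => g (Fin.snoc w.1.2 w.2) :=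
    hg.comp (measurable_appendView n)
  rw [privateLaw, lintegral_map hg (measurable_appendView n), Measure.lintegral_compProd hg',
    lintegral_prod_symm _ (measurable_lintegral_channel hg).aemeasurable]
  exact lintegral_congr fun z => (lintegral_viewLaw_snoc P hg z).symm

theorem measurable_lintegral_viewLaw [IsMarkovKernel (Q n)] (hg : Measurable g) :
    Measurable fun z : Fin n → Z => ∫⁻ w, g (Fin.snoc z w) ∂viewLaw P (Q n) z := by
  simp_rw [lintegral_viewLaw_snoc P hg]
  exact Measurable.lintegral_prod_left (measurable_lintegral_channel hg)

end

theorem chiSqBound_privateLaw {P P' : Measure ℝ} [IsProbabilityMeasure P]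
    [IsProbabilityMeasure P'] {Q : Channel Z} {n : ℕ} (hQ : ∀ i < n, IsMarkovKernel (Q i))
    {K : ℝ≥0∞} (hK : ∀ i < n, ∀ z, ChiSqBound K (viewLaw P (Q i) z) (viewLaw P' (Q i) z)) :
    ChiSqBound (K ^ n) (privateLaw P Q n) (privateLaw P' Q n) := by
  induction n with
  | zero =>
    intro g hg
    rw [privateLaw, privateLaw, lintegral_dirac' _ hg, lintegral_dirac' _ (hg.pow_const 2),
      pow_zero, one_mul]
  | succ n ih =>
    intro g hg
    have := hQ n n.lt_succ_self
    rw [lintegral_privateLaw_succ P hQ hg, lintegral_privateLaw_succ P' hQ (hg.pow_const 2)]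
    calc (∫⁻ z, ∫⁻ w, g (Fin.snoc z w) ∂viewLaw P (Q n) z ∂privateLaw P Q n) ^ 2
        ≤ K ^ n * ∫⁻ z, (∫⁻ w, g (Fin.snoc z w) ∂viewLaw P (Q n) z) ^ 2 ∂privateLaw P' Q n :=
          ih (fun i hi => hQ i (hi.trans n.lt_succ_self))
            (fun i hi => hK i (hi.trans n.lt_succ_self)) (measurable_lintegral_viewLaw P hg)
      _ ≤ K ^ n * ∫⁻ z, K * ∫⁻ w, g (Fin.snoc z w) ^ 2 ∂viewLaw P' (Q n) z
            ∂privateLaw P' Q n := by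
          gcongr with z
          exact hK n n.lt_succ_self z
            (hg.comp ((measurable_fin_snoc n).comp measurable_prodMk_left))
      _ = K ^ (n + 1) * ∫⁻ z, ∫⁻ w, g (Fin.snoc z w) ^ 2 ∂viewLaw P' (Q n) z
            ∂privateLaw P' Q n := by
          rw [lintegral_const_mul _ (measurable_lintegral_viewLaw P' (hg.pow_const 2)), pow_succ,
            mul_assoc]

theorem chiSqBound_privateLaw_densityLaw {α : ℝ} (hα : 0 ≤ α) {f f' : ℝ → ℝ} (hf : IsDensity f)
    (hf' : IsDensity f') {Q : Channel Z} {n : ℕ} (hQ : IsLocallyPrivate α n Q) {δ : ℝ≥0}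
    (hδ : (Real.exp α - 1) * (∫ x, |f x - f' x|) ≤ δ) :
    ChiSqBound ((1 + (δ : ℝ≥0∞) ^ 2) ^ n) (privateLaw (densityLaw f) Q n)
      (privateLaw (densityLaw f') Q n) := by
  have := hf.isProbabilityMeasure
  have := hf'.isProbabilityMeasure
  refine chiSqBound_privateLaw (fun i hi => (hQ i hi).1) fun i hi z => ?_
  have := (hQ i hi).1
  exact chiSqBound_viewLaw (Q i) z hα hf hf' ((hQ i hi).2 z) hδ

end PrivateLaw

/-! ### Assouad's lemma -/

theorem ChiSqBound.one_le_of_add_eq_one {X : Type*} [MeasurableSpace X] {μ ν : Measure X}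
    [IsProbabilityMeasure μ] [IsProbabilityMeasure ν] (hμν : ChiSqBound 2 μ ν)
    {g h : X → ℝ≥0∞} (hg : Measurable g) (hh : Measurable h) (hgh : ∀ x, g x + h x = 1) :
    1 ≤ 2 * (∫⁻ x, g x ∂μ + ∫⁻ x, h x ^ 2 ∂ν) := by
  have hsum : ∫⁻ x, g x ∂μ + ∫⁻ x, h x ∂μ = 1 := by
    rw [← lintegral_add_left hg]
    simp only [hgh, lintegral_one, measure_univ]
  have hsq : ∫⁻ x, h x ^ 2 ∂ν ≤ 1 :=
    calc ∫⁻ x, h x ^ 2 ∂ν ≤ ∫⁻ _, 1 ∂ν :=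
          lintegral_mono fun x => pow_le_one₀ zero_le (hgh x ▸ le_add_self)
      _ = 1 := by rw [lintegral_one, measure_univ]
  have hχ := hμν hh
  have hg_top := ne_top_of_le_ne_top ENNReal.one_ne_top (hsum ▸ le_self_add)
  have hh_top := ne_top_of_le_ne_top ENNReal.one_ne_top (hsum ▸ le_add_self)
  have hsq_top := ne_top_of_le_ne_top ENNReal.one_ne_top hsq
  lift ∫⁻ x, g x ∂μ to ℝ≥0 using hg_top with a
  lift ∫⁻ x, h x ∂μ to ℝ≥0 using hh_top with b
  lift ∫⁻ x, h x ^ 2 ∂ν to ℝ≥0 using hsq_top with c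
  norm_cast at hsum hχ ⊢
  have hsum' : (a : ℝ) + b = 1 := mod_cast hsum
  have hχ' : (b : ℝ) ^ 2 ≤ 2 * c := mod_cast hχ
  have : (1 : ℝ) ≤ 2 * (a + c) := by
    nlinarith [hsum', hχ', sq_nonneg ((b : ℝ) - 1)]
  exact mod_cast this

theorem ChiSqBound.le_two_mul_lintegral_add {X : Type*} [MeasurableSpace X] {μ ν : Measure X}
    [IsProbabilityMeasure μ] [IsProbabilityMeasure ν] (hμν : ChiSqBound 2 μ ν)
    {A B : X → ℝ≥0∞} (hA : Measurable A) {a : ℝ≥0∞} (ha : a ≠ ⊤) (hAB : ∀ x, a ≤ A x + B x) :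
    a ≤ 2 * (∫⁻ x, A x ∂μ + ∫⁻ x, B x ∂ν) := by
  rcases eq_or_ne a 0 with rfl | ha0
  · exact zero_le
  set g : X → ℝ≥0∞ := fun x => min (A x / a) 1
  have hg : Measurable g := (hA.div_const a).min measurable_const
  have hg_one : ∀ x, g x ≤ 1 := fun x => min_le_right _ _
  have hgA : ∀ x, a * g x ≤ A x := fun x =>
    calc a * g x ≤ a * (A x / a) := by gcongr; exact min_le_left _ _
      _ = A x := ENNReal.mul_div_cancel ha0 ha
  have hgB : ∀ x, a * (1 - g x) ^ 2 ≤ B x := fun x => by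
    have : a * (1 - g x) ≤ B x := by
      rw [ENNReal.mul_sub (fun _ _ => ha), mul_one]
      rcases le_total (A x / a) 1 with hx | hx
      · simp only [g, min_eq_left hx, ENNReal.mul_div_cancel ha0 ha]
        exact tsub_le_iff_left.2 (hAB x)
      · simp [g, min_eq_right hx]
    refine le_trans ?_ this
    gcongr
    exact pow_le_of_le_one zero_le tsub_le_self two_ne_zero
  calc a = a * 1 := (mul_one a).symm
    _ ≤ a * (2 * (∫⁻ x, g x ∂μ + ∫⁻ x, (1 - g x) ^ 2 ∂ν)) := by
        gcongr
        exact hμν.one_le_of_add_eq_one hg (measurable_const.sub hg)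
          fun x => add_tsub_cancel_of_le (hg_one x)
    _ = 2 * (∫⁻ x, a * g x ∂μ + ∫⁻ x, a * (1 - g x) ^ 2 ∂ν) := by
        have hg' : Measurable fun x => (1 - g x) ^ 2 := (measurable_const.sub hg).pow_const 2
        rw [lintegral_const_mul _ hg, lintegral_const_mul _ hg']
        ring
    _ ≤ 2 * (∫⁻ x, A x ∂μ + ∫⁻ x, B x ∂ν) := by
        gcongr with x x
        exacts [hgA x, hgB x]

/-- The neighbour of a vertex `σ` of the hypercube in direction `i`. -/
def flipAt {ι : Type*} [DecidableEq ι] (i : ι) (σ : ι → Bool) : ι → Bool :=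
  Function.update σ i (!σ i)

section Assouad

variable {ι : Type*} [DecidableEq ι] (i : ι) (σ : ι → Bool)

theorem flipAt_involutive : Function.Involutive (flipAt i) := fun σ => by simp [flipAt]

theorem flipAt_self : flipAt i σ i = !σ i := Function.update_self ..

theorem flipAt_of_ne {i l : ι} (h : l ≠ i) (σ : ι → Bool) : flipAt i σ l = σ l :=
  Function.update_of_ne h ..

theorem assouad {X : Type*} [MeasurableSpace X] [Fintype ι] {μ : (ι → Bool) → Measure X}
    [∀ σ, IsProbabilityMeasure (μ σ)] (hχ : ∀ σ i, ChiSqBound 2 (μ σ) (μ (flipAt i σ)))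
    {A : ι → Bool → X → ℝ≥0∞} (hA : ∀ i b, Measurable (A i b)) {a : ℝ≥0∞} (ha : a ≠ ⊤)
    (hAa : ∀ i x, a ≤ A i true x + A i false x) {S : ℝ≥0∞}
    (hS : ∀ σ, ∑ i, ∫⁻ x, A i (σ i) x ∂μ σ ≤ S) : Fintype.card ι * a ≤ 4 * S := by
  have neighbours : ∀ i σ, a ≤ 2 * (∫⁻ x, A i (σ i) x ∂μ σ +
      ∫⁻ x, A i (flipAt i σ i) x ∂μ (flipAt i σ)) := by
    intro i σ
    refine (hχ σ i).le_two_mul_lintegral_add (hA i _) ha fun x => ?_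
    rw [flipAt_self]
    cases σ i
    · simpa only [Bool.not_false, add_comm] using hAa i x
    · simpa only [Bool.not_true] using hAa i x
  have direction : ∀ i, (2 ^ Fintype.card ι : ℝ≥0∞) * a ≤ 4 * ∑ σ, ∫⁻ x, A i (σ i) x ∂μ σ := by
    intro i
    have reindex := Equiv.sum_comp (flipAt_involutive i).toPerm fun σ => ∫⁻ x, A i (σ i) x ∂μ σ
    simp only [Function.Involutive.coe_toPerm] at reindex
    calc (2 ^ Fintype.card ι : ℝ≥0∞) * a = ∑ _σ : ι → Bool, a := by simp
      _ ≤ ∑ σ, 2 * (∫⁻ x, A i (σ i) x ∂μ σ + ∫⁻ x, A i (flipAt i σ i) x ∂μ (flipAt i σ)) :=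
          Finset.sum_le_sum fun σ _ => neighbours i σ
      _ = 4 * ∑ σ, ∫⁻ x, A i (σ i) x ∂μ σ := by
          rw [← Finset.mul_sum, Finset.sum_add_distrib, reindex]; ring
  have total : (2 ^ Fintype.card ι : ℝ≥0∞) * (Fintype.card ι * a) ≤
      2 ^ Fintype.card ι * (4 * S) :=
    calc (2 ^ Fintype.card ι : ℝ≥0∞) * (Fintype.card ι * a)
        = ∑ _i : ι, (2 ^ Fintype.card ι : ℝ≥0∞) * a := by
          rw [Finset.sum_const, Finset.card_univ, nsmul_eq_mul]; ring
      _ ≤ ∑ i, 4 * ∑ σ, ∫⁻ x, A i (σ i) x ∂μ σ := Finset.sum_le_sum fun i _ => direction i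
      _ = 4 * ∑ σ, ∑ i, ∫⁻ x, A i (σ i) x ∂μ σ := by rw [← Finset.mul_sum, Finset.sum_comm]
      _ ≤ 4 * ∑ _σ : ι → Bool, S := by gcongr with σ; exact hS σ
      _ = 2 ^ Fintype.card ι * (4 * S) := by simp; ring
  exact (ENNReal.mul_le_mul_iff_right (by simp) (by simp)).1 total

end Assouad

/-- The bits `true` and `false` as the signs `1` and `-1`. -/
def bitSign (b : Bool) : ℝ := if b then 1 else -1

theorem abs_bitSign (b : Bool) : |bitSign b| = 1 := by cases b <;> simp [bitSign]

theorem rpow_abs_le_add_rpow_abs (u b h : ℝ) {r : ℝ} (hr : 0 ≤ r) :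
    |h| ^ r ≤ |u - (b + bitSign true * h)| ^ r + |u - (b + bitSign false * h)| ^ r := by
  have hmax : |h| ≤ max |u - (b + bitSign true * h)| |u - (b + bitSign false * h)| := by
    simp only [bitSign, if_true, Bool.false_eq_true, if_false]
    rcases le_total 0 (u - b) with h' | h' <;> grind
  rcases le_max_iff.1 hmax with h' | h'
  · exact (Real.rpow_le_rpow (abs_nonneg _) h' hr).trans (le_add_of_nonneg_right (by positivity))
  · exact (Real.rpow_le_rpow (abs_nonneg _) h' hr).trans (le_add_of_nonneg_left (by positivity))

/-- A hypercube of densities: `f σ` is a base function `b` perturbed by `± h i` on the `i`-th of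
the disjoint cells `I i`, the sign being `σ i`. -/
structure IsHypercube {ι : Type*} (f : (ι → Bool) → ℝ → ℝ) (b : ℝ → ℝ) (h : ι → ℝ → ℝ)
    (I : ι → Set ℝ) : Prop where
  isDensity : ∀ σ, IsDensity (f σ)
  measurable_base : Measurable b
  measurable_bump : ∀ i, Measurable (h i)
  measurableSet_cell : ∀ i, MeasurableSet (I i)
  disjoint_cells : Pairwise (Function.onFun Disjoint I)
  eq_on_cell : ∀ σ i, ∀ x ∈ I i, f σ x = b x + bitSign (σ i) * h i x

section Hypercube

variable {ι : Type*} {f : (ι → Bool) → ℝ → ℝ} {b : ℝ → ℝ} {h : ι → ℝ → ℝ} {I : ι → Set ℝ}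

theorem IsHypercube.measurable_loss (hf : IsHypercube f b h I) {Y : Type*} [MeasurableSpace Y]
    {fhat : Y → ℝ → ℝ} (hfhat : Measurable (Function.uncurry fhat)) (r : ℝ) (i : ι) (c : Bool) :
    Measurable fun w : Y × ℝ =>
      ENNReal.ofReal (|fhat w.1 w.2 - (b w.2 + bitSign c * h i w.2)| ^ r) :=
  ((hfhat.sub ((hf.measurable_base.comp measurable_snd).add
    (((hf.measurable_bump i).comp measurable_snd).const_mul _))).abs.pow_const r).ennreal_ofReal

theorem IsHypercube.setLIntegral_rpow_le (hf : IsHypercube f b h I) {g : ℝ → ℝ}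
    (hg : Measurable g) {r : ℝ} (hr : 0 ≤ r) (i : ι) :
    ∫⁻ x in I i, ENNReal.ofReal (|h i x| ^ r) ≤
      (∫⁻ x in I i, ENNReal.ofReal (|g x - (b x + bitSign true * h i x)| ^ r)) +
      ∫⁻ x in I i, ENNReal.ofReal (|g x - (b x + bitSign false * h i x)| ^ r) := by
  have hmeas : Measurable fun x => ENNReal.ofReal (|g x - (b x + bitSign true * h i x)| ^ r) :=
    (hf.measurable_loss (Y := Unit) (fhat := fun _ => g) (hg.comp measurable_snd) r i true).comp
      (measurable_prodMk_left (x := ()))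
  rw [← lintegral_add_left hmeas]
  refine lintegral_mono fun x => ?_
  rw [← ENNReal.ofReal_add (by positivity) (by positivity)]
  exact ENNReal.ofReal_le_ofReal (rpow_abs_le_add_rpow_abs _ _ _ hr)

theorem IsHypercube.sum_setLIntegral_le_lrLoss [Fintype ι] (hf : IsHypercube f b h I) (r : ℝ)
    (g : ℝ → ℝ) (σ : ι → Bool) :
    ∑ i, ∫⁻ x in I i, ENNReal.ofReal (|g x - (b x + bitSign (σ i) * h i x)| ^ r) ≤
      lrLoss r g (f σ) :=
  calc ∑ i, ∫⁻ x in I i, ENNReal.ofReal (|g x - (b x + bitSign (σ i) * h i x)| ^ r)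
      = ∑ i, ∫⁻ x in I i, ENNReal.ofReal (|g x - f σ x| ^ r) :=
        Finset.sum_congr rfl fun i _ => setLIntegral_congr_fun (hf.measurableSet_cell i)
          fun x hx => by simp only [hf.eq_on_cell σ i x hx]
    _ = ∫⁻ x in ⋃ i, I i, ENNReal.ofReal (|g x - f σ x| ^ r) := by
        rw [lintegral_iUnion hf.measurableSet_cell hf.disjoint_cells, tsum_fintype]
    _ ≤ lrLoss r g (f σ) := setLIntegral_le_lintegral _ _

theorem IsHypercube.le_privateMinimaxRisk [Fintype ι] [DecidableEq ι] (hf : IsHypercube f b h I)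
    {F : Set (ℝ → ℝ)} (hfF : ∀ σ, f σ ∈ F) {α : ℝ} (hα : 0 ≤ α) {n : ℕ} {r : ℝ} (hr : 0 ≤ r)
    {δ : ℝ≥0} (hδ : ∀ σ i, (Real.exp α - 1) * (∫ x, |f σ x - f (flipAt i σ) x|) ≤ δ)
    (hδn : (1 + (δ : ℝ≥0∞) ^ 2) ^ n ≤ 2) {a : ℝ≥0∞} (ha : a ≠ ⊤)
    (hah : ∀ i, a ≤ ∫⁻ x in I i, ENNReal.ofReal (|h i x| ^ r)) :
    Fintype.card ι * a / 4 ≤ privateMinimaxRisk.{u} α n r F := by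
  rw [privateMinimaxRisk]
  refine le_iInf fun Z => le_iInf fun mZ => le_iInf fun Q => le_iInf fun hQ =>
    le_iInf fun fhat => le_iInf fun hfhat => ENNReal.div_le_of_le_mul' ?_
  have hM : ∀ σ, IsProbabilityMeasure (privateLaw (densityLaw (f σ)) Q n) := fun σ =>
    have := (hf.isDensity σ).isProbabilityMeasure
    isProbabilityMeasure_privateLaw _ fun i hi => (hQ i hi).1
  have hmeas := fun i c => (hf.measurable_loss hfhat r i c).lintegral_prod_right'
    (ν := volume.restrict (I i))
  refine assouad (μ := fun σ => privateLaw (densityLaw (f σ)) Q n) (fun σ i g hg => ?_)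
    (A := fun i c z => ∫⁻ x in I i, ENNReal.ofReal (|fhat z x - (b x + bitSign c * h i x)| ^ r))
    hmeas ha (fun i z => (hah i).trans ?_) fun σ => ?_
  · exact (chiSqBound_privateLaw_densityLaw hα (hf.isDensity σ) (hf.isDensity _) hQ (hδ σ i)
      hg).trans (by gcongr)
  · exact hf.setLIntegral_rpow_le (hfhat.comp measurable_prodMk_left) hr i
  · rw [← lintegral_finsetSum _ fun i _ => hmeas i (σ i)]
    exact le_iSup₂_of_le (f σ) (hfF σ)
      (lintegral_mono fun z => hf.sum_setLIntegral_le_lrLoss r (fhat z) σ)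

end Hypercube

/-! ### Dilations and orthogonality across scales -/

section Dyadic

variable {g g' h : ℝ → ℝ}

theorem quasiMeasurePreserving_dyadic (j k : ℤ) :
    Measure.QuasiMeasurePreserving (fun x : ℝ => (2 : ℝ) ^ j * x - k) volume volume := by
  have hdil : Measure.QuasiMeasurePreserving (fun x : ℝ => (2 : ℝ) ^ j * x) volume volume := by
    refine ⟨by fun_prop, ?_⟩
    rw [Real.map_volume_mul_left (zpow_ne_zero _ two_ne_zero)]
    exact Measure.smul_absolutelyContinuous
  exact (measurePreserving_sub_right volume (k : ℝ)).quasiMeasurePreserving.comp hdil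

theorem dyadic_congr_ae (hg : g =ᵐ[volume] g') (j k : ℤ) :
    dyadic g j k =ᵐ[volume] dyadic g' j k := by
  filter_upwards [(quasiMeasurePreserving_dyadic j k).ae_eq_comp hg] with x hx
  exact congrArg _ hx

theorem dyadic_dyadic (g : ℝ → ℝ) (i j k : ℤ) :
    dyadic (dyadic g i k) j 0 = dyadic g (i + j) k := by
  funext x
  simp only [dyadic, Int.cast_zero, sub_zero, Int.cast_add, add_div]
  rw [Real.rpow_add two_pos, zpow_add₀ two_ne_zero, ← mul_assoc, ← mul_assoc,
    mul_comm ((2 : ℝ) ^ ((j : ℝ) / 2))]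

theorem two_rpow_half_mul_self (j : ℤ) :
    (2 : ℝ) ^ ((j : ℝ) / 2) * (2 : ℝ) ^ ((j : ℝ) / 2) = (2 : ℝ) ^ j := by
  rw [← Real.rpow_add two_pos, add_halves, Real.rpow_intCast]

theorem integral_comp_dyadic (F : ℝ → ℝ) (j k : ℤ) :
    ∫ x, F ((2 : ℝ) ^ j * x - k) = ((2 : ℝ) ^ j)⁻¹ * ∫ y, F y := by
  rw [Measure.integral_comp_mul_left (fun y => F (y - k)) ((2 : ℝ) ^ j),
    integral_sub_right_eq_self F (k : ℝ), abs_of_pos (by positivity), smul_eq_mul]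

theorem integral_dyadic_mul_dyadic (g h : ℝ → ℝ) (j : ℤ) :
    ∫ x, dyadic g j 0 x * dyadic h j 0 x = ∫ y, g y * h y :=
  calc ∫ x, dyadic g j 0 x * dyadic h j 0 x
      = ∫ x, (2 : ℝ) ^ j * (fun y => g y * h y) ((2 : ℝ) ^ j * x - (0 : ℤ)) := by
        refine integral_congr_ae (.of_forall fun x => ?_)
        simp only [dyadic, ← two_rpow_half_mul_self j]
        ring
    _ = ∫ y, g y * h y := by
        rw [integral_const_mul, integral_comp_dyadic (fun y => g y * h y),
          mul_inv_cancel_left₀ (zpow_ne_zero j two_ne_zero)]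

theorem inner_toLp_eq_integral (hg : MemLp g 2 volume) (hh : MemLp h 2 volume) :
    inner ℝ (hg.toLp g) (hh.toLp h) = ∫ x, g x * h x := by
  rw [L2.inner_def]
  refine integral_congr_ae ?_
  filter_upwards [hg.coeFn_toLp, hh.coeFn_toLp] with x hgx hhx
  rw [hgx, hhx, RCLike.inner_apply', conj_trivial]

theorem inner_dyadicL2 (hg : MemLp g 2 volume) (hh : MemLp h 2 volume) (j k j' k' : ℤ) :
    inner ℝ (dyadicL2 g hg j k) (dyadicL2 h hh j' k') =
      ∫ x, dyadic g j k x * dyadic h j' k' x :=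
  inner_toLp_eq_integral _ _

theorem dyadicL2_congr_ae (hg : MemLp g 2 volume) (hg' : MemLp g' 2 volume)
    (hgg' : g =ᵐ[volume] g') : dyadicL2 g hg = dyadicL2 g' hg' := by
  funext j k
  exact (MemLp.toLp_eq_toLp_iff _ _).2 (dyadic_congr_ae hgg' j k)

/-- The unitary dilation `f ↦ 2^{j/2} f(2^j ·)` of `L²(ℝ)`, which carries `dyadicL2 g hg i k` to
`dyadicL2 g hg (i + j) k`. -/
def dilation (j : ℤ) :
    Lp ℝ 2 (volume : Measure ℝ) →ₗᵢ[ℝ] Lp ℝ 2 (volume : Measure ℝ) where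
  toFun f := dyadicL2 f (Lp.memLp f) j 0
  map_add' f g := by
    rw [dyadicL2, dyadicL2, dyadicL2, ← MemLp.toLp_add]
    refine (MemLp.toLp_eq_toLp_iff _ _).2 ((dyadic_congr_ae (Lp.coeFn_add f g) j 0).trans ?_)
    exact .of_forall fun x => mul_add _ _ _
  map_smul' c f := by
    rw [dyadicL2, dyadicL2, RingHom.id_apply, ← MemLp.toLp_const_smul]
    refine (MemLp.toLp_eq_toLp_iff _ _).2 ((dyadic_congr_ae (Lp.coeFn_smul c f) j 0).trans ?_)
    exact .of_forall fun x => mul_left_comm _ _ _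
  norm_map' f := by
    have hsq : ‖dyadicL2 f (Lp.memLp f) j 0‖ ^ 2 = ‖f‖ ^ 2 := by
      rw [← real_inner_self_eq_norm_sq, ← real_inner_self_eq_norm_sq, inner_dyadicL2,
        integral_dyadic_mul_dyadic, ← inner_toLp_eq_integral (Lp.memLp f) (Lp.memLp f),
        Lp.toLp_coeFn]
    exact (sq_eq_sq₀ (norm_nonneg _) (norm_nonneg _)).1 hsq

theorem dilation_dyadicL2 (hg : MemLp g 2 volume) (i j k : ℤ) :
    dilation j (dyadicL2 g hg i k) = dyadicL2 g hg (i + j) k := by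
  change dyadicL2 (dyadicL2 g hg i k) (Lp.memLp _) j 0 = _
  have hcoe : (dyadicL2 g hg i k : ℝ → ℝ) =ᵐ[volume] dyadic g i k := MemLp.coeFn_toLp _
  rw [dyadicL2_congr_ae _ (memLp_dyadic hg i k) hcoe]
  simp only [dyadicL2, dyadic_dyadic]

theorem dyadicL2_eq_dilation (hg : MemLp g 2 volume) (j k : ℤ) :
    dyadicL2 g hg j k = dilation j (dyadicL2 g hg 0 k) := by
  rw [dilation_dyadicL2, zero_add]

theorem dyadicL2_mem_levelSpace (hg : MemLp g 2 volume) (j k : ℤ) :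
    dyadicL2 g hg j k ∈ levelSpace g hg j :=
  Submodule.le_topologicalClosure _ (Submodule.subset_span ⟨k, rfl⟩)

theorem dilation_mem_levelSpace (hg : MemLp g 2 volume) {i : ℤ} (j : ℤ)
    {f : Lp ℝ 2 (volume : Measure ℝ)} (hf : f ∈ levelSpace g hg i) :
    dilation j f ∈ levelSpace g hg (i + j) := by
  have hspan : Submodule.span ℝ (Set.range (dyadicL2 g hg i)) ≤
      (Submodule.span ℝ (Set.range (dyadicL2 g hg (i + j)))).comap (dilation j).toLinearMap := by
    rw [Submodule.span_le]
    rintro _ ⟨k, rfl⟩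
    exact Submodule.subset_span ⟨k, (dilation_dyadicL2 hg i j k).symm⟩
  exact map_mem_closure (dilation j).continuous hf fun x hx => hspan hx

theorem levelSpace_le_of_forall_dyadicL2_mem (hg : MemLp g 2 volume) {j : ℤ}
    {K : Submodule ℝ (Lp ℝ 2 (volume : Measure ℝ))}
    (hK : IsClosed (K : Set (Lp ℝ 2 (volume : Measure ℝ)))) (h : ∀ k, dyadicL2 g hg j k ∈ K) :
    levelSpace g hg j ≤ K :=
  Submodule.topologicalClosure_minimal _ (Submodule.span_le.2 (Set.range_subset_iff.2 h)) hK

theorem orthonormal_dyadicL2 {hg : MemLp g 2 volume} (h : Orthonormal ℝ (dyadicL2 g hg 0))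
    (j : ℤ) : Orthonormal ℝ (dyadicL2 g hg j) := by
  rw [show dyadicL2 g hg j = dilation j ∘ dyadicL2 g hg 0 from
    funext fun k => dyadicL2_eq_dilation hg j k]
  exact h.comp_linearIsometry (dilation j)

end Dyadic

/-- `φ` and `ψ` satisfy the conditions on the father and the mother wavelet of a multiresolution
analysis, except for those that make the wavelet basis complete in `L²(ℝ)`. -/
structure IsWaveletPair (φ ψ : ℝ → ℝ) (hφ : MemLp φ 2 volume) (hψ : MemLp ψ 2 volume) :
    Prop where
  orthonormal_father : Orthonormal ℝ (dyadicL2 φ hφ 0)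
  orthonormal_mother : Orthonormal ℝ (dyadicL2 ψ hψ 0)
  nested : levelSpace φ hφ 0 ≤ levelSpace φ hφ 1
  mother_le : levelSpace ψ hψ 0 ≤ levelSpace φ hφ 1 ⊓ (levelSpace φ hφ 0)ᗮ

section IsWaveletPair

variable {φ ψ : ℝ → ℝ} {hφ : MemLp φ 2 volume} {hψ : MemLp ψ 2 volume}

theorem IsMotherWavelet.isWaveletPair (hmother : IsMotherWavelet φ ψ hφ hψ)
    (hMRA : GeneratesMRA φ hφ) : IsWaveletPair φ ψ hφ hψ where
  orthonormal_father := hMRA.orthonormal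
  orthonormal_mother := hmother.orthonormal
  nested := hMRA.nested 0
  mother_le := hmother.span_eq.le

namespace IsWaveletPair

theorem congr_ae (h : IsWaveletPair φ ψ hφ hψ) {ψ' : ℝ → ℝ} (hψ' : MemLp ψ' 2 volume)
    (hψψ' : ψ =ᵐ[volume] ψ') : IsWaveletPair φ ψ' hφ hψ' := by
  have hdyadic := dyadicL2_congr_ae hψ hψ' hψψ'
  have hlevel : levelSpace ψ hψ = levelSpace ψ' hψ' := by unfold levelSpace; rw [hdyadic]
  exact ⟨h.orthonormal_father, hdyadic ▸ h.orthonormal_mother, h.nested, hlevel ▸ h.mother_le⟩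

theorem levelSpace_mono (h : IsWaveletPair φ ψ hφ hψ) : Monotone (levelSpace φ hφ) := by
  refine monotone_int_of_le_succ fun j => levelSpace_le_of_forall_dyadicL2_mem hφ
    (Submodule.isClosed_topologicalClosure _) fun k => ?_
  rw [dyadicL2_eq_dilation, add_comm]
  exact dilation_mem_levelSpace hφ j (h.nested (dyadicL2_mem_levelSpace hφ 0 k))

theorem mother_mem_levelSpace (h : IsWaveletPair φ ψ hφ hψ) (j k : ℤ) :
    dyadicL2 ψ hψ j k ∈ levelSpace φ hφ (j + 1) := by
  rw [dyadicL2_eq_dilation, add_comm]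
  exact dilation_mem_levelSpace hφ j (h.mother_le (dyadicL2_mem_levelSpace hψ 0 k)).1

theorem inner_mother_eq_zero (h : IsWaveletPair φ ψ hφ hψ) {i j : ℤ} (hij : i ≤ j) (k : ℤ)
    {v : Lp ℝ 2 (volume : Measure ℝ)} (hv : v ∈ levelSpace φ hφ i) :
    inner ℝ (dyadicL2 ψ hψ j k) v = 0 := by
  have hle : levelSpace φ hφ j ≤ (Submodule.span ℝ {dyadicL2 ψ hψ j k})ᗮ := by
    refine levelSpace_le_of_forall_dyadicL2_mem hφ (Submodule.isClosed_orthogonal _) fun m => ?_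
    rw [Submodule.mem_orthogonal_singleton_iff_inner_left, dyadicL2_eq_dilation hφ,
      dyadicL2_eq_dilation hψ, LinearIsometry.inner_map_map]
    exact (h.mother_le (dyadicL2_mem_levelSpace hψ 0 k)).2 _ (dyadicL2_mem_levelSpace hφ 0 m)
  exact Submodule.mem_orthogonal_singleton_iff_inner_right.1 (hle (h.levelSpace_mono hij hv))

theorem integral_mother_mul_father (h : IsWaveletPair φ ψ hφ hψ) {i j : ℤ} (hij : i ≤ j)
    (k k' : ℤ) : ∫ x, dyadic ψ j k x * dyadic φ i k' x = 0 := by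
  rw [← inner_dyadicL2 hψ hφ]
  exact h.inner_mother_eq_zero hij k (dyadicL2_mem_levelSpace hφ i k')

theorem integral_mother_mul_mother_of_ne (h : IsWaveletPair φ ψ hφ hψ) {j j' : ℤ} (hj : j ≠ j')
    (k k' : ℤ) : ∫ x, dyadic ψ j k x * dyadic ψ j' k' x = 0 := by
  wlog hlt : j' < j generalizing j j' k k'
  · simp_rw [mul_comm (dyadic ψ j k _)]
    exact this hj.symm k' k (lt_of_le_of_ne (not_lt.1 hlt) hj)
  rw [← inner_dyadicL2 hψ hψ]
  exact h.inner_mother_eq_zero (by omega : j' + 1 ≤ j) k (h.mother_mem_levelSpace j' k')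

theorem integral_mother_mul_mother (h : IsWaveletPair φ ψ hφ hψ) (j k k' : ℤ) :
    ∫ x, dyadic ψ j k x * dyadic ψ j k' x = if k = k' then 1 else 0 := by
  rw [← inner_dyadicL2 hψ hψ]
  exact orthonormal_iff_ite.1 (orthonormal_dyadicL2 h.orthonormal_mother j) k k'

end IsWaveletPair

end IsWaveletPair

/-! ### Smoothness passes from the father to the mother wavelet -/

section Smooth

variable {η : ℝ → ℝ}

theorem contDiff_infty_iteratedDeriv (hη : ContDiff ℝ ∞ η) (m : ℕ) :
    ContDiff ℝ ∞ (iteratedDeriv m η) := by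
  rw [iteratedDeriv_eq_iterate]
  exact hη.iterate_deriv m

theorem hasCompactSupport_iteratedDeriv (hη : HasCompactSupport η) (m : ℕ) :
    HasCompactSupport (iteratedDeriv m η) := by
  induction m with
  | zero => rwa [iteratedDeriv_zero]
  | succ m ih => rw [iteratedDeriv_succ]; exact ih.deriv

theorem hasDerivAt_iteratedDeriv (hη : ContDiff ℝ ∞ η) (m : ℕ) (x : ℝ) :
    HasDerivAt (iteratedDeriv m η) (iteratedDeriv (m + 1) η x) x := by
  rw [iteratedDeriv_succ]
  exact ((contDiff_infty_iteratedDeriv hη m).differentiable (by simp) x).hasDerivAt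

theorem iteratedDeriv_comp_mul_add (hη : ContDiff ℝ ∞ η) (m : ℕ) (c b y : ℝ) :
    iteratedDeriv m (fun y => η (c * (y + b))) y = c ^ m * iteratedDeriv m η (c * (y + b)) := by
  have hmul : iteratedDeriv m (fun y => η (c * y)) = fun y => c ^ m * iteratedDeriv m η (c * y) :=
    iteratedDeriv_comp_const_mul (hη.of_le (mod_cast le_top)) c
  rw [iteratedDeriv_comp_add_const (n := m) (f := fun y => η (c * y)) (s := b), hmul]

theorem hasCompactSupport_comp_mul_add (hη : HasCompactSupport η) {c : ℝ} (hc : c ≠ 0) (b : ℝ) :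
    HasCompactSupport fun y => η (c * (y + b)) :=
  hη.comp_homeomorph ((Homeomorph.addRight b).trans (Homeomorph.mulLeft₀ c hc))

end Smooth

section WeakDeriv

variable {m : ℕ} {f G : ℝ → ℝ}

theorem integral_dyadic_mul (f : ℝ → ℝ) (j k : ℤ) (η : ℝ → ℝ) :
    ∫ x, dyadic f j k x * η x = (2 : ℝ) ^ ((j : ℝ) / 2) *
      (((2 : ℝ) ^ j)⁻¹ * ∫ y, f y * η (((2 : ℝ) ^ j)⁻¹ * (y + k))) := by
  rw [← integral_comp_dyadic (fun y => f y * η (((2 : ℝ) ^ j)⁻¹ * (y + k))) j k,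
    ← integral_const_mul]
  refine integral_congr_ae (.of_forall fun x => ?_)
  simp only [dyadic, sub_add_cancel, inv_mul_cancel_left₀ (zpow_ne_zero j (two_ne_zero' ℝ)),
    mul_assoc]

theorem HasWeakDerivOfOrder.integral_dyadic_mul_iteratedDeriv (h : HasWeakDerivOfOrder m f G)
    {η : ℝ → ℝ} (hη : ContDiff ℝ ∞ η) (hηc : HasCompactSupport η) (j k : ℤ) :
    ∫ x, dyadic f j k x * iteratedDeriv m η x =
      (-1) ^ m * (((2 : ℝ) ^ j) ^ m * ∫ x, dyadic G j k x * η x) := by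
  have h2 : (2 : ℝ) ^ j ≠ 0 := zpow_ne_zero j two_ne_zero
  have hweak := h.2.2 (fun y => η (((2 : ℝ) ^ j)⁻¹ * (y + k))) (hη.comp (by fun_prop))
    (hasCompactSupport_comp_mul_add hηc (inv_ne_zero h2) k)
  simp_rw [iteratedDeriv_comp_mul_add hη, mul_left_comm (f _), integral_const_mul] at hweak
  have hscaled : ∫ y, f y * iteratedDeriv m η (((2 : ℝ) ^ j)⁻¹ * (y + k)) =
      ((2 : ℝ) ^ j) ^ m * ((-1) ^ m * ∫ y, G y * η (((2 : ℝ) ^ j)⁻¹ * (y + k))) := by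
    rw [← hweak, inv_pow, mul_inv_cancel_left₀ (pow_ne_zero m h2)]
  rw [integral_dyadic_mul, integral_dyadic_mul, hscaled]
  ring

theorem ae_sum_abs_dyadic_le {B : ℝ≥0} (hB : ∀ᵐ x : ℝ, ∑' k : ℤ, ‖G (x - k)‖ₑ ≤ B) (j : ℤ) :
    ∀ᵐ x : ℝ, ∀ S : Finset ℤ, ∑ k ∈ S, |dyadic G j k x| ≤ (2 : ℝ) ^ ((j : ℝ) / 2) * B := by
  filter_upwards [(quasiMeasurePreserving_dyadic j 0).ae hB] with x hx S
  simp only [Int.cast_zero, sub_zero] at hx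
  have hsum : ∑ k ∈ S, |G ((2 : ℝ) ^ j * x - k)| ≤ B := by
    have htoReal := ENNReal.toReal_mono ENNReal.coe_ne_top ((ENNReal.sum_le_tsum S).trans hx)
    rw [ENNReal.toReal_sum fun k _ => enorm_ne_top] at htoReal
    simpa only [toReal_enorm, Real.norm_eq_abs, ENNReal.coe_toReal] using htoReal
  simp only [dyadic, abs_mul, abs_of_pos (Real.rpow_pos_of_pos two_pos _), ← Finset.mul_sum]
  gcongr

theorem sum_abs_integral_dyadic_mul_le (hG : AEStronglyMeasurable G volume) {B : ℝ≥0}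
    (hB : ∀ᵐ x : ℝ, ∑' k : ℤ, ‖G (x - k)‖ₑ ≤ B) (j : ℤ) {η : ℝ → ℝ} (hη : Integrable η)
    (S : Finset ℤ) :
    ∑ k ∈ S, |∫ x, dyadic G j k x * η x| ≤ (2 : ℝ) ^ ((j : ℝ) / 2) * B * ∫ x, |η x| := by
  have hbound := ae_sum_abs_dyadic_le hB j
  have hint (k : ℤ) : Integrable fun x => dyadic G j k x * η x :=
    hη.bdd_mul ((hG.comp_quasiMeasurePreserving (quasiMeasurePreserving_dyadic j k)).const_mul _)
      (hbound.mono fun x hx => by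
        simpa only [Finset.sum_singleton, Real.norm_eq_abs] using hx {k})
  calc ∑ k ∈ S, |∫ x, dyadic G j k x * η x|
      ≤ ∑ k ∈ S, ∫ x, |dyadic G j k x * η x| :=
        Finset.sum_le_sum fun k _ => abs_integral_le_integral_abs
    _ = ∫ x, (∑ k ∈ S, |dyadic G j k x|) * |η x| := by
        rw [← integral_finsetSum _ fun k _ => (hint k).abs]
        simp only [abs_mul, Finset.sum_mul]
    _ ≤ ∫ x, (2 : ℝ) ^ ((j : ℝ) / 2) * B * |η x| := by
        refine integral_mono_of_nonneg (.of_forall fun x => by positivity)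
          (hη.abs.const_mul _) ?_
        filter_upwards [hbound] with x hx
        exact mul_le_mul_of_nonneg_right (hx S) (abs_nonneg _)
    _ = (2 : ℝ) ^ ((j : ℝ) / 2) * B * ∫ x, |η x| := integral_const_mul _ _

end WeakDeriv

theorem abs_inner_le_of_mem_closure_span {ι E : Type*} [NormedAddCommGroup E]
    [InnerProductSpace ℝ E] {v : ι → E} (hv : Orthonormal ℝ v) {w : E} {M : ℝ}
    (hM : ∀ S : Finset ι, ∑ k ∈ S, |inner ℝ (v k) w| ≤ M) {f : E}
    (hf : f ∈ (Submodule.span ℝ (Set.range v)).topologicalClosure) :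
    |inner ℝ f w| ≤ ‖f‖ * M := by
  have hclosed : IsClosed {f : E | |inner ℝ f w| ≤ ‖f‖ * M} :=
    isClosed_le (by fun_prop) (by fun_prop)
  refine closure_minimal (fun g hg => ?_) hclosed hf
  obtain ⟨c, rfl⟩ := Finsupp.mem_span_range_iff_exists_finsupp.1 hg
  rw [Finsupp.sum]
  set g := ∑ k ∈ c.support, c k • v k with hgdef
  have hcoeff : ∀ k ∈ c.support, |c k| ≤ ‖g‖ := fun k hk => by
    rw [← hv.inner_right_sum c hk, ← hgdef]
    simpa only [hv.1 k, one_mul] using abs_real_inner_le_norm (v k) g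
  calc |inner ℝ g w| = |∑ k ∈ c.support, c k * inner ℝ (v k) w| := by
        simp only [hgdef, sum_inner, real_inner_smul_left]
    _ ≤ ∑ k ∈ c.support, |c k| * |inner ℝ (v k) w| := by
        simpa only [abs_mul] using
          Finset.abs_sum_le_sum_abs (fun k => c k * inner ℝ (v k) w) c.support
    _ ≤ ∑ k ∈ c.support, ‖g‖ * |inner ℝ (v k) w| := by
        gcongr with k hk
        exact hcoeff k hk
    _ ≤ ‖g‖ * M := by
        rw [← Finset.mul_sum]
        exact mul_le_mul_of_nonneg_left (hM _) (norm_nonneg _)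

/-- The distributional derivative of order `m` of `ψ` is bounded by `K`, tested against smooth
compactly supported functions. -/
def HasDistribDerivBound (m : ℕ) (K : ℝ) (ψ : ℝ → ℝ) : Prop :=
  ∀ η : ℝ → ℝ, ContDiff ℝ ∞ η → HasCompactSupport η →
    |∫ x, ψ x * iteratedDeriv m η x| ≤ K * ∫ x, |η x|

theorem IsWaveletPair.hasDistribDerivBound {φ ψ : ℝ → ℝ} {hφ : MemLp φ 2 volume}
    {hψ : MemLp ψ 2 volume} (h : IsWaveletPair φ ψ hφ hψ) {m : ℕ} {G : ℝ → ℝ}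
    (hG : HasWeakDerivOfOrder m φ G) {B : ℝ≥0} (hB : ∀ᵐ x : ℝ, ∑' k : ℤ, ‖G (x - k)‖ₑ ≤ B) :
    ∃ K, HasDistribDerivBound m K ψ := by
  refine ⟨((2 : ℝ) ^ (1 : ℤ)) ^ m * ((2 : ℝ) ^ (((1 : ℤ) : ℝ) / 2) * B), fun η hη hηc => ?_⟩
  have hH : MemLp (iteratedDeriv m η) 2 volume :=
    (contDiff_infty_iteratedDeriv hη m).continuous.memLp_of_hasCompactSupport
      (hasCompactSupport_iteratedDeriv hηc m)
  have hfather (S : Finset ℤ) : ∑ k ∈ S, |inner ℝ (dyadicL2 φ hφ 1 k) (hH.toLp _)| ≤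
      ((2 : ℝ) ^ (1 : ℤ)) ^ m * ((2 : ℝ) ^ (((1 : ℤ) : ℝ) / 2) * B * ∫ x, |η x|) := by
    have hterm (k : ℤ) : |inner ℝ (dyadicL2 φ hφ 1 k) (hH.toLp _)| =
        ((2 : ℝ) ^ (1 : ℤ)) ^ m * |∫ x, dyadic G 1 k x * η x| := by
      rw [dyadicL2, inner_toLp_eq_integral, hG.integral_dyadic_mul_iteratedDeriv hη hηc,
        abs_mul, abs_neg_one_pow, one_mul, abs_mul, abs_of_pos (by positivity)]
    simp only [hterm, ← Finset.mul_sum]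
    gcongr
    exact sum_abs_integral_dyadic_mul_le hG.2.1.aestronglyMeasurable hB 1
      (hη.continuous.integrable_of_hasCompactSupport hηc) S
  have hmother := abs_inner_le_of_mem_closure_span (orthonormal_dyadicL2 h.orthonormal_father 1)
    hfather (h.mother_mem_levelSpace 0 0)
  have hψ0 : dyadic ψ 0 0 = ψ := by funext x; simp [dyadic]
  rwa [h.orthonormal_mother.1 0, one_mul, dyadicL2, inner_toLp_eq_integral, hψ0, ← mul_assoc]
    at hmother

/-! ### Smoothness and orthogonality imply vanishing moments -/

section Taylor

variable {h ψ : ℝ → ℝ} {R C : ℝ} {l : ℕ}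

theorem abs_sub_taylor_le (hh : ContDiff ℝ ∞ h) (hC : ∀ x, |iteratedDeriv (l + 1) h x| ≤ C)
    (x₀ t : ℝ) :
    |h (x₀ + t) - ∑ i ∈ Finset.range (l + 1), iteratedDeriv i h x₀ / i.factorial * t ^ i| ≤
      C * |t| ^ (l + 1) := by
  have hC0 : 0 ≤ C := (abs_nonneg _).trans (hC 0)
  rcases eq_or_ne t 0 with rfl | ht
  · simp [Finset.sum_range_succ']
  have hne : x₀ ≠ x₀ + t := by simpa using ht
  obtain ⟨ξ, -, hξ⟩ := taylor_mean_remainder_lagrange_iteratedDeriv (n := l) hne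
    (hh.of_le (mod_cast le_top)).contDiffOn
  have hsum : taylorWithinEval h l (Set.uIcc x₀ (x₀ + t)) x₀ (x₀ + t) =
      ∑ i ∈ Finset.range (l + 1), iteratedDeriv i h x₀ / i.factorial * t ^ i := by
    rw [taylor_within_apply]
    refine Finset.sum_congr rfl fun i _ => ?_
    rw [iteratedDerivWithin_eq_iteratedDeriv (uniqueDiffOn_uIcc hne)
      (hh.of_le (mod_cast le_top)).contDiffAt Set.left_mem_uIcc]
    simp only [add_sub_cancel_left, smul_eq_mul]
    field_simp
  have hfac : (1 : ℝ) ≤ (l + 1).factorial := mod_cast (l + 1).factorial_pos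
  rw [← hsum, hξ, abs_div, abs_mul, abs_pow, add_sub_cancel_left, Nat.abs_cast]
  calc |iteratedDeriv (l + 1) h ξ| * |t| ^ (l + 1) / (l + 1).factorial
      ≤ C * |t| ^ (l + 1) / 1 := by gcongr; exact hC ξ
    _ = C * |t| ^ (l + 1) := div_one _

theorem integrable_mul_of_continuous {k : ℝ → ℝ} (hψ : Integrable ψ)
    (hR : ∀ x, R < |x| → ψ x = 0) (hk : Continuous k) : Integrable fun x => k x * ψ x := by
  obtain ⟨C, hC⟩ := (isCompact_Icc (a := -R) (b := R)).exists_bound_of_continuousOn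
    hk.continuousOn
  refine Integrable.mono' (hψ.abs.const_mul C)
    (hk.aestronglyMeasurable.mul hψ.aestronglyMeasurable) (.of_forall fun x => ?_)
  rcases lt_or_ge R |x| with hx | hx
  · simp [hR x hx]
  · rw [norm_mul, Real.norm_eq_abs (ψ x)]
    exact mul_le_mul_of_nonneg_right (hC x (abs_le.1 hx)) (abs_nonneg _)

theorem integral_sum_pow_mul (hψ : ∀ i : ℕ, Integrable fun y => y ^ i * ψ y)
    (hmom : ∀ i < l, ∫ y, y ^ i * ψ y = 0) (c : ℕ → ℝ) :
    ∫ y, (∑ i ∈ Finset.range (l + 1), c i * y ^ i) * ψ y = c l * ∫ y, y ^ l * ψ y := by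
  simp_rw [Finset.sum_mul, mul_assoc]
  rw [integral_finsetSum _ fun i _ => (hψ i).const_mul _, Finset.sum_range_succ,
    Finset.sum_eq_zero, zero_add, integral_const_mul]
  intro i hi
  rw [integral_const_mul, hmom i (Finset.mem_range.1 hi), mul_zero]

theorem abs_integral_sub_moment_le (hψ : Integrable ψ) (hR : ∀ x, R < |x| → ψ x = 0)
    (hh : ContDiff ℝ ∞ h) (hC : ∀ x, |iteratedDeriv (l + 1) h x| ≤ C)
    (hmom : ∀ i < l, ∫ y, y ^ i * ψ y = 0) (x₀ : ℝ) {δ : ℝ} (hδ : 0 ≤ δ) :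
    |(∫ y, h (x₀ + δ * y) * ψ y) -
      iteratedDeriv l h x₀ / l.factorial * δ ^ l * ∫ y, y ^ l * ψ y| ≤
      C * (δ * R) ^ (l + 1) * ∫ y, |ψ y| := by
  have hC0 : 0 ≤ C := (abs_nonneg _).trans (hC 0)
  set P : ℝ → ℝ := fun y =>
    ∑ i ∈ Finset.range (l + 1), iteratedDeriv i h x₀ / i.factorial * δ ^ i * y ^ i
  have hremainder (y : ℝ) (hy : |y| ≤ R) : |h (x₀ + δ * y) - P y| ≤ C * (δ * R) ^ (l + 1) := by
    have htaylor := abs_sub_taylor_le hh hC x₀ (δ * y)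
    simp only [mul_pow, ← mul_assoc] at htaylor
    refine htaylor.trans ?_
    rw [abs_mul, abs_of_nonneg hδ]
    gcongr
  have hhψ : Integrable fun y => h (x₀ + δ * y) * ψ y :=
    integrable_mul_of_continuous hψ hR (hh.continuous.comp (by fun_prop))
  have hPψ : Integrable fun y => P y * ψ y := integrable_mul_of_continuous hψ hR (by fun_prop)
  rw [← integral_sum_pow_mul (fun i => integrable_mul_of_continuous hψ hR (by fun_prop)) hmom
      fun i => iteratedDeriv i h x₀ / i.factorial * δ ^ i,
    ← integral_sub hhψ hPψ, ← integral_const_mul]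
  refine abs_integral_le_integral_abs.trans (integral_mono_of_nonneg
    (.of_forall fun y => abs_nonneg _) (hψ.abs.const_mul _) (.of_forall fun y => ?_))
  simp only [← sub_mul, abs_mul]
  rcases lt_or_ge R |y| with hy | hy
  · simp [hR y hy]
  · exact mul_le_mul_of_nonneg_right (hremainder y hy) (abs_nonneg _)

end Taylor

/-- A sequence of smooth bumps shrinking to the origin, for mollification. -/
def shrinkingBump (n : ℕ) : ContDiffBump (0 : ℝ) where
  rIn := 1 / (n + 1) / 2
  rOut := 1 / (n + 1)
  rIn_pos := by positivity
  rIn_lt_rOut := half_lt_self (by positivity)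

theorem shrinkingBump_rOut_le (n : ℕ) : (shrinkingBump n).rOut ≤ 1 :=
  (div_le_one (by positivity)).2 (le_add_of_nonneg_left n.cast_nonneg)

/-- The mollification of `ψ` at scale `1 / (n + 1)`. -/
def mollify (ψ : ℝ → ℝ) (n : ℕ) : ℝ → ℝ :=
  convolution ((shrinkingBump n).normed volume) ψ (ContinuousLinearMap.lsmul ℝ ℝ) volume

section Mollify

variable {ψ : ℝ → ℝ}

theorem contDiff_mollify (hψ : LocallyIntegrable ψ) (n : ℕ) : ContDiff ℝ ∞ (mollify ψ n) :=
  (shrinkingBump n).hasCompactSupport_normed.contDiff_convolution_left _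
    (shrinkingBump n).contDiff_normed hψ

theorem iteratedDeriv_mollify (hψ : LocallyIntegrable ψ) (n i : ℕ) :
    iteratedDeriv i (mollify ψ n) =
      convolution (iteratedDeriv i ((shrinkingBump n).normed volume)) ψ
        (ContinuousLinearMap.lsmul ℝ ℝ) volume := by
  induction i with
  | zero => simp only [iteratedDeriv_zero, mollify]
  | succ i ih =>
    funext x
    rw [iteratedDeriv_succ, ih, iteratedDeriv_succ]
    exact (HasCompactSupport.hasDerivAt_convolution_left _
      (hasCompactSupport_iteratedDeriv (shrinkingBump n).hasCompactSupport_normed i)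
      ((contDiff_infty_iteratedDeriv (shrinkingBump n).contDiff_normed i).of_le
        (mod_cast le_top)) hψ x).deriv

theorem mollify_eq_zero {R : ℝ} (hR : ∀ x, R < |x| → ψ x = 0) (n : ℕ) {x : ℝ}
    (hx : R + 1 < |x|) : mollify ψ n x = 0 := by
  rw [mollify, convolution_def]
  refine integral_eq_zero_of_ae (.of_forall fun t => ?_)
  rcases lt_or_ge |t| 1 with ht | ht
  · have hxt : R < |x - t| := by linarith [abs_sub_abs_le_abs_sub x t]
    simp [hR _ hxt]
  · have ht' : t ∉ Function.support ((shrinkingBump n).normed volume) := by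
      rw [ContDiffBump.support_normed_eq, Metric.mem_ball, dist_zero_right, Real.norm_eq_abs]
      exact not_lt.2 ((shrinkingBump_rOut_le n).trans ht)
    simp [Function.notMem_support.1 ht']

theorem iteratedDeriv_mollify_eq_zero {R : ℝ} (hR : ∀ x, R < |x| → ψ x = 0) (n i : ℕ) {x : ℝ}
    (hx : R + 1 < |x|) : iteratedDeriv i (mollify ψ n) x = 0 := by
  have hzero : Set.EqOn (mollify ψ n) 0 {x | R + 1 < |x|} := fun y hy => mollify_eq_zero hR n hy
  rw [hzero.iteratedDeriv_of_isOpen (isOpen_lt continuous_const continuous_abs) i hx]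
  simp

theorem ae_tendsto_mollify (hψ : LocallyIntegrable ψ) :
    ∀ᵐ x, Filter.Tendsto (fun n => mollify ψ n x) Filter.atTop (nhds (ψ x)) := by
  refine ContDiffBump.ae_convolution_tendsto_right_of_locallyIntegrable (K := 2)
    tendsto_one_div_add_atTop_nhds_zero_nat (.of_forall fun n => ?_) hψ
  change (1 : ℝ) / (n + 1) ≤ 2 * (1 / (n + 1) / 2)
  linarith

theorem tendsto_integral_mul_mollify (hψ : LocallyIntegrable ψ) {C : ℝ}
    (hC : ∀ n x, |mollify ψ n x| ≤ C) {g : ℝ → ℝ} (hg : Integrable g) :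
    Filter.Tendsto (fun n => ∫ x, g x * mollify ψ n x) Filter.atTop
      (nhds (∫ x, g x * ψ x)) := by
  refine tendsto_integral_of_dominated_convergence (fun x => |g x| * C)
    (fun n => hg.aestronglyMeasurable.mul (contDiff_mollify hψ n).continuous.aestronglyMeasurable)
    (hg.abs.mul_const C) (fun n => .of_forall fun x => ?_) ?_
  · rw [norm_mul]
    exact mul_le_mul_of_nonneg_left (hC n x) (abs_nonneg _)
  · filter_upwards [ae_tendsto_mollify hψ] with x hx
    exact hx.const_mul _

theorem HasDistribDerivBound.abs_iteratedDeriv_mollify_le {m : ℕ} {K : ℝ}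
    (hK : HasDistribDerivBound m K ψ) (hψ : LocallyIntegrable ψ) (n : ℕ) (x : ℝ) :
    |iteratedDeriv m (mollify ψ n) x| ≤ K := by
  set ρ := (shrinkingBump n).normed (volume : Measure ℝ) with hρ
  have hρ_smooth : ContDiff ℝ ∞ ρ := (shrinkingBump n).contDiff_normed
  have htest := hK (fun y => ρ (x - y)) (hρ_smooth.comp (by fun_prop))
    ((shrinkingBump n).hasCompactSupport_normed.comp_homeomorph (Homeomorph.subLeft x))
  have hmass : ∫ y, |ρ (x - y)| = 1 := by
    have hnonneg (y : ℝ) : |ρ (x - y)| = ρ (x - y) :=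
      abs_of_nonneg ((shrinkingBump n).nonneg_normed _)
    simp_rw [hnonneg]
    rw [integral_sub_left_eq_self ρ volume x, hρ, ContDiffBump.integral_normed]
  have hderiv : iteratedDeriv m (mollify ψ n) x =
      (-1) ^ m * ∫ y, ψ y * iteratedDeriv m (fun y => ρ (x - y)) y := by
    rw [iteratedDeriv_mollify hψ, convolution_eq_swap, ← integral_const_mul]
    refine integral_congr_ae (.of_forall fun y => ?_)
    simp only [iteratedDeriv_comp_const_sub, smul_eq_mul, ContinuousLinearMap.lsmul_apply, ← hρ]
    have hsign : ((-1 : ℝ) ^ m) * (-1) ^ m = 1 := by rw [← mul_pow]; simp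
    linear_combination (-ψ y * iteratedDeriv m ρ (x - y)) * hsign
  rw [hderiv, abs_mul, abs_neg_one_pow, one_mul]
  rwa [hmass, mul_one] at htest

end Mollify

section CompactSupport

variable {R C : ℝ}

theorem eq_intervalIntegral_of_hasDerivAt {u v : ℝ → ℝ} (hd : ∀ x, HasDerivAt u (v x) x)
    (hv : Continuous v) (hR : u (-R) = 0) (x : ℝ) : u x = ∫ y in (-R)..x, v y := by
  rw [intervalIntegral.integral_eq_sub_of_hasDerivAt (fun y _ => hd y)
    (hv.intervalIntegrable _ _), hR, sub_zero]

theorem abs_le_of_hasDerivAt_of_support {u v : ℝ → ℝ} (hR : 0 ≤ R)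
    (hd : ∀ x, HasDerivAt u (v x) x) (hv : Continuous v) (hu : ∀ x, R ≤ |x| → u x = 0)
    (hC : ∀ x, |v x| ≤ C) (x : ℝ) : |u x| ≤ C * (2 * R) := by
  have hC0 : 0 ≤ C := (abs_nonneg _).trans (hC 0)
  rcases le_or_gt R |x| with hx | hx
  · rw [hu x hx, abs_zero]
    positivity
  · rw [eq_intervalIntegral_of_hasDerivAt hd hv (hu (-R) (by simp [abs_of_nonneg hR])) x,
      ← Real.norm_eq_abs]
    refine (intervalIntegral.norm_integral_le_of_norm_le_const fun y _ => hC y).trans ?_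
    gcongr
    rw [abs_le]
    constructor <;> linarith [(abs_lt.1 hx).1, (abs_lt.1 hx).2]

theorem tendsto_zero_of_hasDerivAt_of_support {u v : ℕ → ℝ → ℝ} (hR : 0 ≤ R)
    (hd : ∀ n x, HasDerivAt (u n) (v n x) x) (hv : ∀ n, Continuous (v n))
    (hu : ∀ n x, R ≤ |x| → u n x = 0) (hC : ∀ n x, |v n x| ≤ C)
    (hlim : ∀ x, Filter.Tendsto (fun n => v n x) Filter.atTop (nhds 0)) (x : ℝ) :
    Filter.Tendsto (fun n => u n x) Filter.atTop (nhds 0) := by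
  simp_rw [fun n => eq_intervalIntegral_of_hasDerivAt (hd n) (hv n)
    (hu n (-R) (by simp [abs_of_nonneg hR])) x]
  simpa only [intervalIntegral.integral_zero] using
    intervalIntegral.tendsto_integral_filter_of_dominated_convergence (μ := volume)
      (a := -R) (b := x) (F := v) (f := fun _ => (0 : ℝ)) (fun _ => C)
      (.of_forall fun n => (hv n).aestronglyMeasurable)
      (.of_forall fun n => .of_forall fun y _ => hC n y)
      intervalIntegrable_const (.of_forall fun y _ => hlim y)

end CompactSupport

section Moments

variable {ψ : ℝ → ℝ} {R K : ℝ} {m l : ℕ}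

theorem exists_bound_iteratedDeriv_mollify (hψ : LocallyIntegrable ψ) (hR0 : 0 ≤ R)
    (hR : ∀ x, R < |x| → ψ x = 0) (hK : HasDistribDerivBound m K ψ) {i : ℕ} (hi : i ≤ m) :
    ∃ C, ∀ n x, |iteratedDeriv i (mollify ψ n) x| ≤ C := by
  induction hi using Nat.decreasingInduction with
  | self => exact ⟨K, hK.abs_iteratedDeriv_mollify_le hψ⟩
  | of_succ i _ ih =>
    obtain ⟨C, hC⟩ := ih
    exact ⟨C * (2 * (R + 2)), fun n => abs_le_of_hasDerivAt_of_support (by positivity)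
      (hasDerivAt_iteratedDeriv (contDiff_mollify hψ n) i)
      (contDiff_infty_iteratedDeriv (contDiff_mollify hψ n) _).continuous
      (fun x hx => iteratedDeriv_mollify_eq_zero hR n i (by linarith)) (hC n)⟩

theorem HasDistribDerivBound.exists_ae_bound (hK : HasDistribDerivBound m K ψ)
    (hψ : LocallyIntegrable ψ) (hR0 : 0 ≤ R) (hR : ∀ x, R < |x| → ψ x = 0) :
    ∃ B, ∀ᵐ x, |ψ x| ≤ B := by
  obtain ⟨C, hC⟩ := exists_bound_iteratedDeriv_mollify hψ hR0 hR hK m.zero_le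
  refine ⟨C, ?_⟩
  filter_upwards [ae_tendsto_mollify hψ] with x hx
  exact le_of_tendsto hx.abs (.of_forall fun n => by simpa only [iteratedDeriv_zero] using hC n x)

theorem tendsto_integral_mollify_dilated (hψ : Integrable ψ) (hR0 : 0 ≤ R)
    (hR : ∀ x, R < |x| → ψ x = 0) (hK : HasDistribDerivBound m K ψ) {j k : ℤ}
    (horth : ∫ x, dyadic ψ j k x * ψ x = 0) :
    Filter.Tendsto (fun n => ∫ y, mollify ψ n (((2 : ℝ) ^ j)⁻¹ * k + ((2 : ℝ) ^ j)⁻¹ * y) * ψ y)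
      Filter.atTop (nhds 0) := by
  obtain ⟨C, hC⟩ := exists_bound_iteratedDeriv_mollify hψ.locallyIntegrable hR0 hR hK m.zero_le
  simp only [iteratedDeriv_zero] at hC
  have hdyadic : Integrable (dyadic ψ j k) :=
    ((hψ.comp_sub_right (k : ℝ)).comp_mul_left' (zpow_ne_zero j two_ne_zero)).const_mul _
  have hlim := tendsto_integral_mul_mollify hψ.locallyIntegrable hC hdyadic
  simp_rw [integral_dyadic_mul ψ j k (mollify ψ _), horth, ← mul_assoc] at hlim
  have hscale : (2 : ℝ) ^ ((j : ℝ) / 2) * ((2 : ℝ) ^ j)⁻¹ ≠ 0 := by positivity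
  have hlim' := hlim.const_mul ((2 : ℝ) ^ ((j : ℝ) / 2) * ((2 : ℝ) ^ j)⁻¹)⁻¹
  simp_rw [inv_mul_cancel_left₀ hscale, mul_zero] at hlim'
  refine hlim'.congr fun n => ?_
  simp only [mul_add, add_comm, mul_comm (ψ _)]

theorem exists_eventually_abs_iteratedDeriv_mollify_le (hψ : Integrable ψ) (hR0 : 0 ≤ R)
    (hR : ∀ x, R < |x| → ψ x = 0) (hK : HasDistribDerivBound m K ψ)
    (horth : ∀ j k : ℤ, 1 ≤ j → ∫ x, dyadic ψ j k x * ψ x = 0) (hl : l < m)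
    (hmom : ∀ i < l, ∫ y, y ^ i * ψ y = 0) (hM : ∫ y, y ^ l * ψ y ≠ 0) :
    ∃ E, ∀ j k : ℤ, 1 ≤ j → ∀ᶠ n in Filter.atTop,
      |iteratedDeriv l (mollify ψ n) (((2 : ℝ) ^ j)⁻¹ * k)| ≤ E * ((2 : ℝ) ^ j)⁻¹ := by
  obtain ⟨C, hC⟩ := exists_bound_iteratedDeriv_mollify hψ.locallyIntegrable hR0 hR hK
    (Nat.succ_le_of_lt hl)
  set M := ∫ y, y ^ l * ψ y
  set w : ℝ := |M| / l.factorial with hw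
  have hw0 : 0 < w := by positivity
  refine ⟨w⁻¹ * (C * R ^ (l + 1) * (∫ y, |ψ y|) + 1), fun j k hj => ?_⟩
  set δ : ℝ := ((2 : ℝ) ^ j)⁻¹
  have hδ : 0 < δ := by positivity
  have hlim := tendsto_integral_mollify_dilated hψ hR0 hR hK (horth j k hj)
  filter_upwards [hlim.abs.eventually_le_const (show |(0 : ℝ)| < δ ^ (l + 1) by
    rw [abs_zero]; positivity)] with n hn
  have htaylor := abs_integral_sub_moment_le hψ hR (contDiff_mollify hψ.locallyIntegrable n)
    (hC n) hmom (δ * k) hδ.le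
  set a := ∫ y, mollify ψ n (δ * k + δ * y) * ψ y
  set D := iteratedDeriv l (mollify ψ n) (δ * k)
  have hD : |D / l.factorial * δ ^ l * M| = |D| * w * δ ^ l := by
    rw [abs_mul, abs_mul, abs_div, abs_pow, abs_of_pos hδ, Nat.abs_cast, hw]
    ring
  have hDle : |D| * w * δ ^ l ≤ (C * R ^ (l + 1) * (∫ y, |ψ y|) + 1) * δ * δ ^ l := by
    have htri := abs_sub_abs_le_abs_sub (D / l.factorial * δ ^ l * M) a
    rw [abs_sub_comm, hD] at htri
    calc |D| * w * δ ^ l ≤ C * (δ * R) ^ (l + 1) * (∫ y, |ψ y|) + δ ^ (l + 1) := by linarith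
      _ = (C * R ^ (l + 1) * (∫ y, |ψ y|) + 1) * δ * δ ^ l := by ring
  rw [mul_assoc, le_inv_mul_iff₀ hw0, mul_comm w]
  exact le_of_mul_le_mul_right hDle (by positivity)

theorem tendsto_iteratedDeriv_mollify (hψ : Integrable ψ) (hR0 : 0 ≤ R)
    (hR : ∀ x, R < |x| → ψ x = 0) (hK : HasDistribDerivBound m K ψ)
    (horth : ∀ j k : ℤ, 1 ≤ j → ∫ x, dyadic ψ j k x * ψ x = 0) (hl : l < m)
    (hmom : ∀ i < l, ∫ y, y ^ i * ψ y = 0) (hM : ∫ y, y ^ l * ψ y ≠ 0) (x : ℝ) :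
    Filter.Tendsto (fun n => iteratedDeriv l (mollify ψ n) x) Filter.atTop (nhds 0) := by
  obtain ⟨E, hE⟩ := exists_eventually_abs_iteratedDeriv_mollify_le hψ hR0 hR hK horth hl hmom hM
  obtain ⟨C, hC⟩ := exists_bound_iteratedDeriv_mollify hψ.locallyIntegrable hR0 hR hK
    (Nat.succ_le_of_lt hl)
  have hC0 : 0 ≤ C := (abs_nonneg _).trans (hC 0 0)
  have hlip (n : ℕ) (y : ℝ) : |iteratedDeriv l (mollify ψ n) x - iteratedDeriv l (mollify ψ n) y| ≤
      C * |x - y| :=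
    Convex.norm_image_sub_le_of_norm_hasDerivWithin_le (s := Set.univ)
      (fun z _ => (hasDerivAt_iteratedDeriv (contDiff_mollify hψ.locallyIntegrable n) l
        z).hasDerivWithinAt) (fun z _ => hC n z) convex_univ (Set.mem_univ y) (Set.mem_univ x)
  have hscale : Filter.Tendsto (fun i : ℕ => (E + C) * ((2 : ℝ) ^ ((i + 1 : ℕ) : ℤ))⁻¹)
      Filter.atTop (nhds 0) := by
    simp_rw [zpow_natCast, ← inv_pow]
    rw [← mul_zero (E + C)]
    exact ((tendsto_pow_atTop_nhds_zero_of_lt_one (by norm_num) (by norm_num)).comp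
      (Filter.tendsto_add_atTop_nat 1)).const_mul _
  refine (tendsto_zero_iff_abs_tendsto_zero _).2 (tendsto_order.2
    ⟨fun ε hε => .of_forall fun n => hε.trans_le (abs_nonneg _), fun ε hε => ?_⟩)
  obtain ⟨i, hi⟩ := (hscale.eventually_lt_const hε).exists
  set δ : ℝ := ((2 : ℝ) ^ ((i + 1 : ℕ) : ℤ))⁻¹
  have hδ : 0 < δ := by positivity
  have hfloor : |x - δ * ⌊x / δ⌋| ≤ δ := by
    have hfract : x - δ * ⌊x / δ⌋ = δ * Int.fract (x / δ) := by
      rw [Int.fract, mul_sub, mul_div_cancel₀ x hδ.ne']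
    rw [hfract, abs_mul, abs_of_pos hδ, abs_of_nonneg (Int.fract_nonneg _)]
    exact mul_le_of_le_one_right hδ.le (Int.fract_lt_one _).le
  filter_upwards [hE ((i + 1 : ℕ) : ℤ) ⌊x / δ⌋ (by push_cast; omega)] with n hn
  have htri := abs_sub_abs_le_abs_sub (iteratedDeriv l (mollify ψ n) x)
    (iteratedDeriv l (mollify ψ n) (δ * ⌊x / δ⌋))
  have hnear : C * |x - δ * ⌊x / δ⌋| ≤ C * δ := by gcongr
  change |iteratedDeriv l (mollify ψ n) x| < ε
  linarith [hlip n (δ * ⌊x / δ⌋)]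

theorem integral_pow_mul_eq_zero (hψ : Integrable ψ) (hR0 : 0 ≤ R)
    (hR : ∀ x, R < |x| → ψ x = 0) (hK : HasDistribDerivBound m K ψ)
    (horth : ∀ j k : ℤ, 1 ≤ j → ∫ x, dyadic ψ j k x * ψ x = 0)
    (hne : ¬ ψ =ᵐ[volume] 0) (hl : l < m) : ∫ y, y ^ l * ψ y = 0 := by
  induction l using Nat.strong_induction_on with
  | _ l ih =>
  by_contra hM
  have hlim : ∀ i ≤ l, ∀ x, Filter.Tendsto (fun n => iteratedDeriv i (mollify ψ n) x)
      Filter.atTop (nhds 0) := fun i hi => by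
    induction hi using Nat.decreasingInduction with
    | self =>
      exact tendsto_iteratedDeriv_mollify hψ hR0 hR hK horth hl
        (fun i hi => ih i hi (hi.trans hl)) hM
    | of_succ i hi ih_succ =>
      have hsmooth := contDiff_mollify hψ.locallyIntegrable
      obtain ⟨C, hC⟩ := exists_bound_iteratedDeriv_mollify hψ.locallyIntegrable hR0 hR hK
        (show i + 1 ≤ m by omega)
      exact tendsto_zero_of_hasDerivAt_of_support (R := R + 2) (by positivity)
        (fun n => hasDerivAt_iteratedDeriv (hsmooth n) i)
        (fun n => (contDiff_infty_iteratedDeriv (hsmooth n) _).continuous)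
        (fun n x hx => iteratedDeriv_mollify_eq_zero hR n i (by linarith)) hC ih_succ
  refine hne ?_
  filter_upwards [ae_tendsto_mollify hψ.locallyIntegrable] with x hx
  exact tendsto_nhds_unique hx (by
    simpa only [iteratedDeriv_zero, Pi.zero_apply] using hlim 0 l.zero_le x)

end Moments

/-! ### The Besov sequence norm -/

section SequenceNorm

theorem eLpNorm_count_le_tsum {ι ε : Type*} [MeasurableSpace ι] [MeasurableSingletonClass ι]
    [TopologicalSpace ε] [ESeminormedAddMonoid ε] (f : ι → ε) {p : ℝ≥0∞} (hp : 1 ≤ p) :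
    eLpNorm f p Measure.count ≤ ∑' i, ‖f i‖ₑ := by
  have hp0 : p ≠ 0 := (zero_lt_one.trans_le hp).ne'
  rcases eq_or_ne p ⊤ with rfl | hpt
  · rw [eLpNorm_exponent_top, eLpNormEssSup_count]
    exact iSup_le fun i => ENNReal.le_tsum i
  have hp1 : 1 ≤ p.toReal := by
    rwa [← ENNReal.toReal_one, ENNReal.toReal_le_toReal ENNReal.one_ne_top hpt]
  rw [eLpNorm_eq_lintegral_rpow_enorm_toReal hp0 hpt, lintegral_count]
  set S := ∑' i, ‖f i‖ₑ with hS
  have hsplit (x : ℝ≥0∞) : x ^ p.toReal = x * x ^ (p.toReal - 1) := by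
    conv_rhs => rw [← ENNReal.rpow_one x, ← ENNReal.rpow_mul, one_mul]
    rw [← ENNReal.rpow_add_of_nonneg _ _ zero_le_one (sub_nonneg.2 hp1), add_sub_cancel]
  calc (∑' i, ‖f i‖ₑ ^ p.toReal) ^ (1 / p.toReal)
      ≤ (∑' i, ‖f i‖ₑ * S ^ (p.toReal - 1)) ^ (1 / p.toReal) := by
        gcongr with i
        rw [hsplit]
        gcongr
        exact ENNReal.le_tsum i
    _ = (S ^ p.toReal) ^ (1 / p.toReal) := by rw [ENNReal.tsum_mul_right, ← hS, hsplit]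
    _ = S := by rw [← ENNReal.rpow_mul, mul_one_div_cancel (by linarith), ENNReal.rpow_one]

theorem eLpNorm_count_le_of_support {ι : Type*} [MeasurableSpace ι] [MeasurableSingletonClass ι]
    (f : ι → ℝ) (S : Finset ι) {M : ℝ} (hM : 0 ≤ M) (h0 : ∀ k ∉ S, f k = 0)
    (hfM : ∀ k ∈ S, |f k| ≤ M) (p : ℝ≥0∞) :
    eLpNorm f p Measure.count ≤ ENNReal.ofReal M * (S.card : ℝ≥0∞) ^ p.toReal⁻¹ := by
  have hmono : eLpNorm f p Measure.count ≤
      eLpNorm ((S : Set ι).indicator fun _ => M) p Measure.count := by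
    refine eLpNorm_mono_real fun k => ?_
    by_cases hk : k ∈ S
    · rw [Set.indicator_of_mem (Finset.mem_coe.2 hk)]
      exact hfM k hk
    · rw [Set.indicator_of_notMem (Finset.mem_coe.not.2 hk), h0 k hk, norm_zero]
  refine hmono.trans ((eLpNorm_indicator_const_le _ _).trans_eq ?_)
  rw [Real.enorm_of_nonneg hM, Measure.count_apply_finset, one_div]

theorem inv_toReal_le_one {p : ℝ≥0∞} (hp : 1 ≤ p) : p.toReal⁻¹ ≤ 1 := by
  rcases eq_or_ne p ⊤ with rfl | hpt
  · simp
  · refine inv_le_one_of_one_le₀ ?_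
    rwa [← ENNReal.toReal_one, ENNReal.toReal_le_toReal ENNReal.one_ne_top hpt]

theorem card_Icc_ceil_floor_le {a b : ℝ} (hab : a ≤ b) :
    ((Finset.Icc ⌈a⌉ ⌊b⌋).card : ℝ) ≤ b - a + 1 := by
  rw [Int.card_Icc, ← Int.cast_natCast, Int.toNat_eq_max, Int.cast_max, max_le_iff]
  push_cast
  constructor <;> linarith [Int.floor_le b, Int.le_ceil a]

end SequenceNorm

section BesovNorm

variable {f f' g g' φ ψ ψ' : ℝ → ℝ} {s : ℝ} {p q : ℝ≥0∞}

theorem memLp_top_dyadic (hg : MemLp g ⊤ volume) (j k : ℤ) : MemLp (dyadic g j k) ⊤ volume := by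
  refine MemLp.const_mul (f := fun x => g ((2 : ℝ) ^ j * x - k)) ?_ _
  refine memLp_top_of_bound (hg.1.comp_quasiMeasurePreserving (quasiMeasurePreserving_dyadic j k))
    (eLpNorm g ⊤ volume).toReal ?_
  filter_upwards [(quasiMeasurePreserving_dyadic j k).ae (ae_le_eLpNormEssSup (f := g))] with x hx
  rw [← toReal_enorm, eLpNorm_exponent_top]
  exact ENNReal.toReal_mono hg.eLpNorm_ne_top hx

theorem waveletCoeff_congr_ae (h : g =ᵐ[volume] g') (f : ℝ → ℝ) (j k : ℤ) :
    waveletCoeff g f j k = waveletCoeff g' f j k := by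
  refine integral_congr_ae ?_
  filter_upwards [dyadic_congr_ae h j k] with x hx
  rw [hx]

theorem waveletCoeff_congr_ae_right (h : f =ᵐ[volume] f') (g : ℝ → ℝ) (j k : ℤ) :
    waveletCoeff g f j k = waveletCoeff g f' j k := by
  refine integral_congr_ae ?_
  filter_upwards [h] with x hx
  rw [hx]

theorem waveletCoeff_add (hf : Integrable f) (hf' : Integrable f') (hg : MemLp g ⊤ volume)
    (j k : ℤ) :
    waveletCoeff g (fun x => f x + f' x) j k = waveletCoeff g f j k + waveletCoeff g f' j k := by
  simp only [waveletCoeff, add_mul]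
  exact integral_add (hf.mul_of_top_left (memLp_top_dyadic hg j k))
    (hf'.mul_of_top_left (memLp_top_dyadic hg j k))

theorem waveletCoeff_const_mul (c : ℝ) (f g : ℝ → ℝ) (j k : ℤ) :
    waveletCoeff g (fun x => c * f x) j k = c * waveletCoeff g f j k := by
  simp only [waveletCoeff, mul_assoc, integral_const_mul]

/-- The `ℓ^p`-norm of the wavelet coefficients of `f` at level `j`. -/
def levelNorm (g : ℝ → ℝ) (p : ℝ≥0∞) (f : ℝ → ℝ) (j : ℤ) : ℝ≥0∞ :=
  eLpNorm (fun k : ℤ => waveletCoeff g f j k) p Measure.count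

theorem besovNorm_eq_levelNorm_add (φ ψ : ℝ → ℝ) (s : ℝ) (p q : ℝ≥0∞) (f : ℝ → ℝ) :
    besovNorm φ ψ s p q f = levelNorm φ p f 0 +
      eLpNorm (fun j : ℕ => ENNReal.ofReal ((2 : ℝ) ^ ((j : ℝ) * (s + 1 / 2 - p.toReal⁻¹))) *
        levelNorm ψ p f j) q Measure.count :=
  rfl

theorem levelNorm_add_le (hp : 1 ≤ p) (hg : MemLp g ⊤ volume) (hf : Integrable f)
    (hf' : Integrable f') (j : ℤ) :
    levelNorm g p (fun x => f x + f' x) j ≤ levelNorm g p f j + levelNorm g p f' j := by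
  simp only [levelNorm, waveletCoeff_add hf hf' hg]
  exact eLpNorm_add_le measurable_from_top.aestronglyMeasurable
    measurable_from_top.aestronglyMeasurable hp

theorem levelNorm_const_mul (g : ℝ → ℝ) (p : ℝ≥0∞) (c : ℝ) (f : ℝ → ℝ) (j : ℤ) :
    levelNorm g p (fun x => c * f x) j = ‖c‖ₑ * levelNorm g p f j := by
  simp only [levelNorm, waveletCoeff_const_mul]
  exact eLpNorm_const_smul c _ p _

theorem besovNorm_congr_ae_right (h : f =ᵐ[volume] f') (φ ψ : ℝ → ℝ) (s : ℝ) (p q : ℝ≥0∞) :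
    besovNorm φ ψ s p q f = besovNorm φ ψ s p q f' := by
  simp only [besovNorm, waveletCoeff_congr_ae_right h]

theorem besovNorm_congr_ae_wavelet (h : ψ =ᵐ[volume] ψ') (φ : ℝ → ℝ) (s : ℝ) (p q : ℝ≥0∞) :
    besovNorm φ ψ s p q = besovNorm φ ψ' s p q := by
  funext f
  simp only [besovNorm, waveletCoeff_congr_ae h]

theorem besovNorm_add_le (hp : 1 ≤ p) (hq : 1 ≤ q) (hφ : MemLp φ ⊤ volume)
    (hψ : MemLp ψ ⊤ volume) (hf : Integrable f) (hf' : Integrable f') :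
    besovNorm φ ψ s p q (fun x => f x + f' x) ≤
      besovNorm φ ψ s p q f + besovNorm φ ψ s p q f' := by
  simp only [besovNorm_eq_levelNorm_add]
  rw [add_add_add_comm]
  gcongr
  · exact levelNorm_add_le hp hφ hf hf' 0
  · refine (eLpNorm_mono_enorm fun j => ?_).trans
      (eLpNorm_add_le measurable_from_top.aestronglyMeasurable
        measurable_from_top.aestronglyMeasurable hq)
    simp only [enorm_eq_self, Pi.add_apply, ← mul_add]
    gcongr
    exact levelNorm_add_le hp hψ hf hf' j

theorem besovNorm_const_mul_le (φ ψ : ℝ → ℝ) (s : ℝ) (p q : ℝ≥0∞) (c : ℝ) (f : ℝ → ℝ) :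
    besovNorm φ ψ s p q (fun x => c * f x) ≤ ‖c‖ₑ * besovNorm φ ψ s p q f := by
  simp only [besovNorm_eq_levelNorm_add, levelNorm_const_mul]
  rw [mul_add]
  gcongr
  refine eLpNorm_le_mul_eLpNorm_of_ae_le_mul' (c := ‖c‖₊) (.of_forall fun j => ?_) q
  simp only [enorm_eq_self]
  exact (mul_left_comm _ _ _).le

theorem besovNorm_le_tsum (hq : 1 ≤ q) (φ ψ : ℝ → ℝ) (s : ℝ) (p : ℝ≥0∞) (f : ℝ → ℝ) :
    besovNorm φ ψ s p q f ≤ levelNorm φ p f 0 +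
      ∑' j : ℕ, ENNReal.ofReal ((2 : ℝ) ^ ((j : ℝ) * (s + 1 / 2 - p.toReal⁻¹))) *
        levelNorm ψ p f j := by
  rw [besovNorm_eq_levelNorm_add]
  gcongr
  exact eLpNorm_count_le_tsum _ hq

end BesovNorm

/-! ### Smooth functions have finite Besov norm -/

section Smooth

variable {g φ ψ : ℝ → ℝ} {s : ℝ} {p q : ℝ≥0∞} {N : ℕ} {R T C : ℝ}

theorem waveletCoeff_eq_integral (f g : ℝ → ℝ) (j k : ℤ) :
    waveletCoeff g f j k = (2 : ℝ) ^ (-((j : ℝ) / 2)) *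
      ∫ y, f (((2 : ℝ) ^ j)⁻¹ * k + ((2 : ℝ) ^ j)⁻¹ * y) * g y := by
  have hscale : (2 : ℝ) ^ ((j : ℝ) / 2) * ((2 : ℝ) ^ j)⁻¹ = (2 : ℝ) ^ (-((j : ℝ) / 2)) := by
    rw [← Real.rpow_intCast, ← Real.rpow_neg zero_le_two, ← Real.rpow_add two_pos]
    congr 1
    ring
  simp only [waveletCoeff, mul_comm (f _)]
  rw [integral_dyadic_mul, ← mul_assoc, hscale]
  simp only [mul_comm (g _), mul_add, add_comm]

theorem tsum_enorm_translate_le {M : ℝ} (hT : 0 ≤ T) (hg0 : ∀ x, T < |x| → g x = 0)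
    (hgM : ∀ x, |g x| ≤ M) (y : ℝ) :
    ∑' k : ℤ, ‖g (y + k)‖ₑ ≤ ENNReal.ofReal ((2 * T + 1) * M) := by
  have hM0 : 0 ≤ M := (abs_nonneg _).trans (hgM 0)
  set S := Finset.Icc ⌈-T - y⌉ ⌊T - y⌋
  have hS : ∀ k ∉ S, ‖g (y + k)‖ₑ = 0 := by
    intro k hk
    rw [hg0, enorm_zero]
    by_contra! hle
    rw [abs_le] at hle
    refine hk (Finset.mem_Icc.2 ⟨Int.ceil_le.2 ?_, Int.le_floor.2 ?_⟩) <;> linarith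
  have hcard := card_Icc_ceil_floor_le (show -T - y ≤ T - y by linarith)
  calc ∑' k : ℤ, ‖g (y + k)‖ₑ = ∑ k ∈ S, ‖g (y + k)‖ₑ := tsum_eq_sum hS
    _ ≤ ∑ _k ∈ S, ENNReal.ofReal M := by
        gcongr with k
        rw [Real.enorm_eq_ofReal_abs]
        exact ENNReal.ofReal_le_ofReal (hgM _)
    _ = ENNReal.ofReal (S.card * M) := by
        rw [Finset.sum_const, nsmul_eq_mul, ENNReal.ofReal_mul (by positivity),
          ENNReal.ofReal_natCast]
    _ ≤ _ := by
        gcongr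
        linarith

theorem levelNorm_zero_lt_top (hp : 1 ≤ p) (hφ : Integrable φ) {M : ℝ} (hg : Measurable g)
    (hT : 0 ≤ T) (hg0 : ∀ x, T < |x| → g x = 0) (hgM : ∀ x, |g x| ≤ M) :
    levelNorm φ p g 0 < ⊤ := by
  have hcoeff (k : ℤ) : ‖waveletCoeff φ g 0 k‖ₑ ≤ ∫⁻ y, ‖g (y + k)‖ₑ * ‖φ y‖ₑ := by
    rw [waveletCoeff_eq_integral]
    simp only [Int.cast_zero, zero_div, neg_zero, Real.rpow_zero, one_mul, zpow_zero, inv_one]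
    refine (enorm_integral_le_lintegral_enorm _).trans_eq ?_
    simp_rw [enorm_mul, add_comm (k : ℝ)]
  calc levelNorm φ p g 0 ≤ ∑' k : ℤ, ‖waveletCoeff φ g 0 k‖ₑ := eLpNorm_count_le_tsum _ hp
    _ ≤ ∑' k : ℤ, ∫⁻ y, ‖g (y + k)‖ₑ * ‖φ y‖ₑ := ENNReal.tsum_le_tsum hcoeff
    _ = ∫⁻ y, (∑' k : ℤ, ‖g (y + k)‖ₑ) * ‖φ y‖ₑ := by
        simp_rw [← ENNReal.tsum_mul_right]
        refine (lintegral_tsum fun k => ?_).symm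
        exact (hg.comp (measurable_add_const _)).enorm.aemeasurable.mul
          hφ.aestronglyMeasurable.enorm
    _ ≤ ∫⁻ y, ENNReal.ofReal ((2 * T + 1) * M) * ‖φ y‖ₑ := by
        gcongr with y
        exact tsum_enorm_translate_le hT hg0 hgM y
    _ < ⊤ := by
        rw [lintegral_const_mul' _ _ ENNReal.ofReal_ne_top]
        exact ENNReal.mul_lt_top ENNReal.ofReal_lt_top hφ.hasFiniteIntegral

theorem abs_waveletCoeff_le (hψ : Integrable ψ) (hR : ∀ x, R < |x| → ψ x = 0)
    (hmom : ∀ l ≤ N, ∫ y, y ^ l * ψ y = 0) (hg : ContDiff ℝ ∞ g)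
    (hC : ∀ x, |iteratedDeriv (N + 1) g x| ≤ C) (j k : ℤ) :
    |waveletCoeff ψ g j k| ≤ (2 : ℝ) ^ (-((j : ℝ) / 2)) *
      (C * (((2 : ℝ) ^ j)⁻¹ * R) ^ (N + 1) * ∫ y, |ψ y|) := by
  have htaylor := abs_integral_sub_moment_le hψ hR hg hC (fun i hi => hmom i hi.le)
    (((2 : ℝ) ^ j)⁻¹ * k) (by positivity : 0 ≤ ((2 : ℝ) ^ j)⁻¹)
  rw [hmom N le_rfl, mul_zero, sub_zero] at htaylor
  rw [waveletCoeff_eq_integral, abs_mul, abs_of_nonneg (by positivity)]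
  gcongr

theorem waveletCoeff_eq_zero_of_notMem (hR : ∀ x, R < |x| → ψ x = 0)
    (hg0 : ∀ x, T < |x| → g x = 0) {j k : ℤ}
    (hk : k ∉ Finset.Icc ⌈-((2 : ℝ) ^ j * T + R)⌉ ⌊(2 : ℝ) ^ j * T + R⌋) :
    waveletCoeff ψ g j k = 0 := by
  rw [waveletCoeff_eq_integral, integral_eq_zero_of_ae, mul_zero]
  refine .of_forall fun y => ?_
  by_contra hne
  obtain ⟨hg, hψ⟩ := mul_ne_zero_iff.1 hne
  have hy : |y| ≤ R := not_lt.1 fun h => hψ (hR y h)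
  have hx := not_lt.1 fun h => hg (hg0 _ h)
  rw [← mul_add, abs_mul, abs_of_pos (by positivity), inv_mul_le_iff₀ (by positivity)] at hx
  rw [abs_le] at hx hy
  refine hk (Finset.mem_Icc.2 ⟨Int.ceil_le.2 ?_, Int.le_floor.2 ?_⟩) <;> linarith

theorem natCast_rpow_le_of_le_two_pow_mul {n j : ℕ} {D t : ℝ} (hD : 1 ≤ D) (ht0 : 0 ≤ t)
    (ht1 : t ≤ 1) (hn : (n : ℝ) ≤ (2 : ℝ) ^ j * D) :
    (n : ℝ≥0∞) ^ t ≤ ENNReal.ofReal ((2 : ℝ) ^ ((j : ℝ) * t) * D) := by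
  rw [← ENNReal.ofReal_natCast, ENNReal.ofReal_rpow_of_nonneg n.cast_nonneg ht0]
  refine ENNReal.ofReal_le_ofReal ?_
  calc (n : ℝ) ^ t ≤ ((2 : ℝ) ^ j * D) ^ t := by gcongr
    _ = (2 : ℝ) ^ ((j : ℝ) * t) * D ^ t := by
        rw [Real.mul_rpow (by positivity) (by linarith), Real.rpow_mul zero_le_two,
          Real.rpow_natCast]
    _ ≤ (2 : ℝ) ^ ((j : ℝ) * t) * D := by
        gcongr
        exact Real.rpow_le_self_of_one_le hD ht1

theorem two_rpow_weight_mul_decay (s t : ℝ) (N j : ℕ) :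
    (2 : ℝ) ^ ((j : ℝ) * (s + 1 / 2 - t)) * (2 : ℝ) ^ (-((j : ℝ) / 2)) *
      (((2 : ℝ) ^ j)⁻¹) ^ (N + 1) * (2 : ℝ) ^ ((j : ℝ) * t) = ((2 : ℝ) ^ (s - (N + 1))) ^ j := by
  have hdecay : (((2 : ℝ) ^ j)⁻¹) ^ (N + 1) = (2 : ℝ) ^ (-((j : ℝ) * (N + 1))) := by
    rw [inv_pow, ← pow_mul, Real.rpow_neg zero_le_two, ← Real.rpow_natCast]
    push_cast
    rfl
  rw [hdecay, ← Real.rpow_natCast, ← Real.rpow_mul zero_le_two, ← Real.rpow_add two_pos,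
    ← Real.rpow_add two_pos, ← Real.rpow_add two_pos]
  congr 1
  ring

theorem weighted_levelNorm_le (hp : 1 ≤ p) (hψ : Integrable ψ) (hR0 : 0 ≤ R)
    (hR : ∀ x, R < |x| → ψ x = 0) (hmom : ∀ l ≤ N, ∫ y, y ^ l * ψ y = 0)
    (hg : ContDiff ℝ ∞ g) (hT : 0 ≤ T) (hg0 : ∀ x, T < |x| → g x = 0)
    (hC : ∀ x, |iteratedDeriv (N + 1) g x| ≤ C) (s : ℝ) (j : ℕ) :
    ENNReal.ofReal ((2 : ℝ) ^ ((j : ℝ) * (s + 1 / 2 - p.toReal⁻¹))) * levelNorm ψ p g j ≤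
      ENNReal.ofReal ((C * R ^ (N + 1) * ∫ y, |ψ y|) * (2 * T + 2 * R + 1) *
        ((2 : ℝ) ^ (s - (N + 1))) ^ j) := by
  set t := p.toReal⁻¹
  have hC0 : 0 ≤ C := (abs_nonneg _).trans (hC 0)
  have hcoeff := abs_waveletCoeff_le hψ hR hmom hg hC j
  have hsupp (k : ℤ) (hk : k ∉ _) : waveletCoeff ψ g j k = 0 :=
    waveletCoeff_eq_zero_of_notMem hR hg0 hk
  set S := Finset.Icc ⌈-((2 : ℝ) ^ (j : ℤ) * T + R)⌉ ⌊(2 : ℝ) ^ (j : ℤ) * T + R⌋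
  have hcard : (S.card : ℝ) ≤ 2 ^ j * (2 * T + 2 * R + 1) := by
    have hpos : 0 ≤ (2 : ℝ) ^ (j : ℤ) * T + R := by positivity
    have hone : (1 : ℝ) ≤ 2 ^ j := one_le_pow₀ one_le_two
    refine (card_Icc_ceil_floor_le ((neg_nonpos.2 hpos).trans hpos)).trans ?_
    rw [zpow_natCast]
    nlinarith
  set M := (2 : ℝ) ^ (-(((j : ℤ) : ℝ) / 2)) *
    (C * (((2 : ℝ) ^ (j : ℤ))⁻¹ * R) ^ (N + 1) * ∫ y, |ψ y|) with hM
  have hlevel : levelNorm ψ p g j ≤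
      ENNReal.ofReal M * ENNReal.ofReal ((2 : ℝ) ^ ((j : ℝ) * t) * (2 * T + 2 * R + 1)) :=
    (eLpNorm_count_le_of_support _ S (by positivity) hsupp (fun k _ => hcoeff k) p).trans <| by
      gcongr
      exact natCast_rpow_le_of_le_two_pow_mul (by linarith) (by positivity)
        (inv_toReal_le_one hp) hcard
  refine (mul_le_mul_right hlevel _).trans_eq ?_
  rw [← ENNReal.ofReal_mul (by positivity), ← ENNReal.ofReal_mul (by positivity)]
  congr 1
  rw [← two_rpow_weight_mul_decay s t N j, hM, mul_pow, zpow_natCast, Int.cast_natCast]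
  ring

theorem besovNorm_lt_top_of_contDiff (hp : 1 ≤ p) (hq : 1 ≤ q) (hsN : s < N + 1)
    (hφ : Integrable φ) (hψ : Integrable ψ) (hR0 : 0 ≤ R) (hR : ∀ x, R < |x| → ψ x = 0)
    (hmom : ∀ l ≤ N, ∫ y, y ^ l * ψ y = 0) (hg : ContDiff ℝ ∞ g) (hgc : HasCompactSupport g) :
    besovNorm φ ψ s p q g < ⊤ := by
  obtain ⟨M, hM⟩ := hgc.exists_bound_of_continuous hg.continuous
  obtain ⟨C, hC⟩ := (hasCompactSupport_iteratedDeriv hgc (N + 1)).exists_bound_of_continuous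
    (contDiff_infty_iteratedDeriv hg (N + 1)).continuous
  obtain ⟨T, hT, hgT⟩ := hgc.isCompact.isBounded.subset_closedBall_lt 0 0
  have hg0 : ∀ x, T < |x| → g x = 0 := fun x hx => image_eq_zero_of_notMem_tsupport fun hmem =>
    hx.not_ge (mem_closedBall_zero_iff.1 (hgT hmem))
  refine (besovNorm_le_tsum hq φ ψ s p g).trans_lt (ENNReal.add_lt_top.2
    ⟨levelNorm_zero_lt_top hp hφ hg.continuous.measurable hT.le hg0 hM,
      (ENNReal.tsum_le_tsum fun j =>
        weighted_levelNorm_le hp hψ hR0 hR hmom hg hT.le hg0 hC s j).trans_lt ?_⟩)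
  refine ((summable_geometric_of_lt_one (by positivity) ?_).mul_left _).tsum_ofReal_lt_top
  exact Real.rpow_lt_one_of_one_lt_of_neg one_lt_two (by linarith)

end Smooth

section Combination

variable {φ ψ g : ℝ → ℝ} {hφ : MemLp φ 2 volume} {hψ : MemLp ψ 2 volume} {ι : Type*} [Fintype ι]

theorem waveletCoeff_sum_dyadic (hψ : MemLp ψ 2 volume) (hg : MemLp g 2 volume)
    (c : ι → ℝ) (κ : ι → ℤ) (j j' k : ℤ) :
    waveletCoeff g (fun x => ∑ i, c i * dyadic ψ j (κ i) x) j' k =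
      ∑ i, c i * ∫ x, dyadic ψ j (κ i) x * dyadic g j' k x := by
  simp only [waveletCoeff, Finset.sum_mul, mul_assoc]
  refine (integral_finsetSum _ fun i _ => ?_).trans (by simp only [integral_const_mul])
  exact ((memLp_dyadic hψ j (κ i)).integrable_mul (memLp_dyadic hg j' k)).const_mul (c i)

namespace IsWaveletPair

theorem levelNorm_sum_dyadic_le (h : IsWaveletPair φ ψ hφ hψ) {c : ι → ℝ} {γ : ℝ} (hγ : 0 ≤ γ)
    (hc : ∀ i, |c i| ≤ γ) {κ : ι → ℤ} (hκ : Function.Injective κ) (p : ℝ≥0∞) (j : ℤ) :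
    levelNorm ψ p (fun x => ∑ i, c i * dyadic ψ j (κ i) x) j ≤
      ENNReal.ofReal γ * (Fintype.card ι : ℝ≥0∞) ^ p.toReal⁻¹ := by
  classical
  have hcoeff (k : ℤ) : waveletCoeff ψ (fun x => ∑ i, c i * dyadic ψ j (κ i) x) j k =
      ∑ i, if κ i = k then c i else 0 := by
    simp only [waveletCoeff_sum_dyadic hψ hψ, h.integral_mother_mul_mother, mul_ite, mul_one,
      mul_zero]
  rw [← Finset.card_univ, ← Finset.card_image_of_injective _ hκ]
  refine eLpNorm_count_le_of_support _ _ hγ (fun k hk => ?_) (fun k hk => ?_) p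
  · rw [hcoeff]
    refine Finset.sum_eq_zero fun i _ => if_neg ?_
    rintro rfl
    exact hk (Finset.mem_image_of_mem _ (Finset.mem_univ i))
  · obtain ⟨i, -, rfl⟩ := Finset.mem_image.1 hk
    simpa only [hcoeff, hκ.eq_iff, Finset.sum_ite_eq', Finset.mem_univ, if_true] using hc i

theorem besovNorm_sum_dyadic_le (h : IsWaveletPair φ ψ hφ hψ) {q : ℝ≥0∞} (hq : 1 ≤ q)
    {c : ι → ℝ} {γ : ℝ} (hγ : 0 ≤ γ) (hc : ∀ i, |c i| ≤ γ) {κ : ι → ℤ}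
    (hκ : Function.Injective κ) (s : ℝ) (p : ℝ≥0∞) (j : ℕ) :
    besovNorm φ ψ s p q (fun x => ∑ i, c i * dyadic ψ j (κ i) x) ≤
      ENNReal.ofReal ((2 : ℝ) ^ ((j : ℝ) * (s + 1 / 2 - p.toReal⁻¹)) * γ) *
        (Fintype.card ι : ℝ≥0∞) ^ p.toReal⁻¹ := by
  have hfather : levelNorm φ p (fun x => ∑ i, c i * dyadic ψ j (κ i) x) 0 = 0 := by
    simp only [levelNorm, waveletCoeff_sum_dyadic hψ hφ,
      h.integral_mother_mul_father (Int.natCast_nonneg j), mul_zero, Finset.sum_const_zero]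
    exact eLpNorm_zero'
  have hother (j' : ℕ) (hj : j' ≠ j) :
      levelNorm ψ p (fun x => ∑ i, c i * dyadic ψ j (κ i) x) j' = 0 := by
    simp only [levelNorm, waveletCoeff_sum_dyadic hψ hψ,
      h.integral_mother_mul_mother_of_ne (Nat.cast_injective.ne hj.symm), mul_zero,
      Finset.sum_const_zero]
    exact eLpNorm_zero'
  refine (besovNorm_le_tsum hq φ ψ s p _).trans ?_
  rw [hfather, zero_add, tsum_eq_single j fun j' hj => by rw [hother j' hj, mul_zero],
    ENNReal.ofReal_mul (by positivity), mul_assoc]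
  gcongr
  exact h.levelNorm_sum_dyadic_le hγ hc hκ p j

end IsWaveletPair

end Combination

/-! ### A density in the interior of the class -/

section InteriorDensity

variable {φ ψ f g : ℝ → ℝ} {s L L' T R c₀ c₁ : ℝ} {p q : ℝ≥0∞} {N : ℕ}

/-- The probability density `b` lives on `[-T, T]`, is at least `c₀` on `[-T/2, T/2]`, and its Besov
norm stays below `L` by the margin `c₁`, so that small enough perturbations of `b` inside
`[-T/2, T/2]` remain in the Besov class of radius `L`. -/
structure IsInteriorDensity (φ ψ : ℝ → ℝ) (s : ℝ) (p q : ℝ≥0∞) (L T c₀ c₁ : ℝ) (b : ℝ → ℝ) :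
    Prop where
  isDensity : IsDensity b
  measurable : Measurable b
  eq_zero : ∀ x, T < |x| → b x = 0
  le : ∀ x, |x| ≤ T / 2 → c₀ ≤ b x
  besovNorm_add_le : besovNorm φ ψ s p q b + ENNReal.ofReal c₁ ≤ ENNReal.ofReal L

theorem IsDensity.mix (hf : IsDensity f) (hg : IsDensity g) {ε : ℝ} (hε0 : 0 ≤ ε) (hε1 : ε ≤ 1) :
    IsDensity fun x => (1 - ε) * f x + ε * g x where
  integrable := (hf.integrable.const_mul _).add (hg.integrable.const_mul _)
  nonneg x := add_nonneg (mul_nonneg (sub_nonneg.2 hε1) (hf.nonneg x))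
    (mul_nonneg hε0 (hg.nonneg x))
  integral_eq_one := by
    rw [integral_add (hf.integrable.const_mul _) (hg.integrable.const_mul _), integral_const_mul,
      integral_const_mul, hf.integral_eq_one, hg.integral_eq_one]
    ring

theorem mem_densityBesov_of_isDensity (hf : IsDensity f) (hf0 : ∀ x, T < |x| → f x = 0)
    (hfL : besovNorm φ ψ s p q f ≤ ENNReal.ofReal L) : f ∈ densityBesov φ ψ s p q L T := by
  refine ⟨hf.integrable, hf.nonneg, hf.integral_eq_one, ?_, hfL⟩
  refine closure_minimal (fun x hx => ?_) isClosed_Icc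
  rw [Set.mem_Icc, ← abs_le]
  exact not_lt.1 fun h => hx (hf0 x h)

theorem exists_measurable_density (hf : f ∈ densityBesov φ ψ s p q L T) :
    ∃ f', Measurable f' ∧ IsDensity f' ∧ (∀ x, T < |x| → f' x = 0) ∧
      besovNorm φ ψ s p q f' ≤ ENNReal.ofReal L := by
  obtain ⟨hi, h0, h1, hs, hb⟩ := hf
  have hm := hi.aestronglyMeasurable
  set f' : ℝ → ℝ := (Set.Icc (-T) T).indicator fun x => max 0 (hm.mk f x) with hf'
  have hae : f =ᵐ[volume] f' := by
    filter_upwards [hm.ae_eq_mk] with x hx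
    by_cases hxT : x ∈ Set.Icc (-T) T
    · rw [hf', Set.indicator_of_mem hxT, ← hx, max_eq_right (h0 x)]
    · rw [hf', Set.indicator_of_notMem hxT, image_eq_zero_of_notMem_tsupport fun h => hxT (hs h)]
  refine ⟨f', ?_, ⟨hi.congr hae, ?_, ?_⟩, fun x hx => ?_, ?_⟩
  · exact (measurable_const.max hm.stronglyMeasurable_mk.measurable).indicator measurableSet_Icc
  · exact Set.indicator_nonneg fun x _ => le_max_left _ _
  · rw [← integral_congr_ae hae, h1]
  · refine Set.indicator_of_notMem ?_ _
    rwa [Set.mem_Icc, ← abs_le, not_le]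
  · rwa [← besovNorm_congr_ae_right hae]

theorem exists_besovNorm_mix_add_le (hp : 1 ≤ p) (hq : 1 ≤ q) (hφ : MemLp φ ⊤ volume)
    (hψ : MemLp ψ ⊤ volume) (hf : Integrable f) (hg : Integrable g) (hL : 0 < L) (hL' : L' < L)
    (hfL : besovNorm φ ψ s p q f ≤ ENNReal.ofReal L') (hg_top : besovNorm φ ψ s p q g < ⊤) :
    ∃ ε, 0 < ε ∧ ε ≤ 1 ∧ ∃ c₁, 0 < c₁ ∧
      besovNorm φ ψ s p q (fun x => (1 - ε) * f x + ε * g x) + ENNReal.ofReal c₁ ≤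
        ENNReal.ofReal L := by
  have hf_top : besovNorm φ ψ s p q f ≠ ⊤ := ne_top_of_le_ne_top ENNReal.ofReal_ne_top hfL
  set F := (besovNorm φ ψ s p q f).toReal with hF
  set G := (besovNorm φ ψ s p q g).toReal
  have hF0 : 0 ≤ F := ENNReal.toReal_nonneg
  have hG0 : 0 ≤ G := ENNReal.toReal_nonneg
  have hFL : F < L := by
    rw [hF, ← ENNReal.lt_ofReal_iff_toReal_lt hf_top]
    exact hfL.trans_lt ((ENNReal.ofReal_lt_ofReal_iff hL).2 hL')
  have hlim : Filter.Tendsto (fun ε => F + ε * G) (nhdsWithin 0 (Set.Ioi 0)) (nhds F) := by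
    refine tendsto_nhdsWithin_of_tendsto_nhds (Continuous.tendsto' (by fun_prop) _ _ ?_)
    rw [zero_mul, add_zero]
  obtain ⟨ε, hεL, hε0, hε1⟩ :=
    ((hlim.eventually_lt_const hFL).and (Ioc_mem_nhdsGT one_pos)).exists
  refine ⟨ε, hε0, hε1, L - (F + ε * G), sub_pos.2 hεL, ?_⟩
  have hmix : besovNorm φ ψ s p q (fun x => (1 - ε) * f x + ε * g x) ≤
      ENNReal.ofReal (F + ε * G) := by
    rw [ENNReal.ofReal_add hF0 (mul_nonneg hε0.le hG0), ENNReal.ofReal_mul hε0.le,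
      ENNReal.ofReal_toReal hf_top, ENNReal.ofReal_toReal hg_top.ne]
    refine (besovNorm_add_le hp hq hφ hψ (hf.const_mul _) (hg.const_mul _)).trans
      (add_le_add ((besovNorm_const_mul_le φ ψ s p q _ f).trans (mul_le_of_le_one_left' ?_))
        ((besovNorm_const_mul_le φ ψ s p q ε g).trans_eq ?_))
    · rw [Real.enorm_of_nonneg (sub_nonneg.2 hε1), ENNReal.ofReal_le_one]
      exact sub_le_self 1 hε0.le
    · rw [Real.enorm_of_nonneg hε0.le]
  refine (add_le_add_left hmix _).trans_eq ?_
  rw [← ENNReal.ofReal_add (by positivity) (sub_nonneg.2 hεL.le), add_sub_cancel]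

/-- A smooth bump on `[-T, T]` that is constant on `[-T/2, T/2]`. -/
def wideBump (hT : 0 < T) : ContDiffBump (0 : ℝ) where
  rIn := T / 2
  rOut := T
  rIn_pos := half_pos hT
  rIn_lt_rOut := half_lt_self hT

theorem isDensity_normed_wideBump (hT : 0 < T) : IsDensity ((wideBump hT).normed volume) :=
  ⟨(wideBump hT).integrable_normed, (wideBump hT).nonneg_normed, (wideBump hT).integral_normed⟩

theorem normed_wideBump_eq_zero (hT : 0 < T) {x : ℝ} (hx : T < |x|) :
    (wideBump hT).normed volume x = 0 := by
  rw [← Function.notMem_support, ContDiffBump.support_normed_eq, mem_ball_zero_iff,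
    Real.norm_eq_abs]
  exact not_lt.2 hx.le

theorem normed_wideBump_eq (hT : 0 < T) {x : ℝ} (hx : |x| ≤ T / 2) :
    (wideBump hT).normed volume x = 1 / ∫ y, wideBump hT y := by
  rw [ContDiffBump.normed_def, ContDiffBump.one_of_mem_closedBall]
  rwa [mem_closedBall_zero_iff, Real.norm_eq_abs]

theorem exists_isInteriorDensity (hp : 1 ≤ p) (hq : 1 ≤ q) (hsN : s < N + 1)
    (hφ : Integrable φ) (hφ_top : MemLp φ ⊤ volume) (hψ : Integrable ψ)
    (hψ_top : MemLp ψ ⊤ volume) (hR0 : 0 ≤ R) (hR : ∀ x, R < |x| → ψ x = 0)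
    (hmom : ∀ l ≤ N, ∫ y, y ^ l * ψ y = 0) (hL : 0 < L) (hT : 0 < T)
    (hne : ∃ L' < L, (densityBesov φ ψ s p q L' T).Nonempty) :
    ∃ b c₀ c₁, 0 < c₀ ∧ 0 < c₁ ∧ IsInteriorDensity φ ψ s p q L T c₀ c₁ b := by
  obtain ⟨L', hL', f₀, hf₀⟩ := hne
  obtain ⟨f, hfm, hf, hf0, hfL⟩ := exists_measurable_density hf₀
  set g := (wideBump hT).normed (volume : Measure ℝ)
  have hg : IsDensity g := isDensity_normed_wideBump hT
  have hg0 : ∀ x, T < |x| → g x = 0 := fun x => normed_wideBump_eq_zero hT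
  have hg_mid : ∀ x, |x| ≤ T / 2 → g x = 1 / ∫ y, wideBump hT y := fun x => normed_wideBump_eq hT
  have hg_smooth : ContDiff ℝ ∞ g := (wideBump hT).contDiff_normed
  obtain ⟨ε, hε0, hε1, c₁, hc₁, hmix⟩ := exists_besovNorm_mix_add_le hp hq hφ_top hψ_top
    hf.integrable hg.integrable hL hL' hfL (besovNorm_lt_top_of_contDiff hp hq hsN hφ hψ hR0 hR
      hmom hg_smooth (wideBump hT).hasCompactSupport_normed)
  have hbump := (wideBump hT).integral_pos (μ := (volume : Measure ℝ))
  refine ⟨_, ε * (1 / ∫ y, wideBump hT y), c₁, by positivity, hc₁, hf.mix hg hε0.le hε1,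
    (hfm.const_mul _).add (hg_smooth.continuous.measurable.const_mul _), fun x hx => ?_,
    fun x hx => ?_, hmix⟩
  · rw [hf0 x hx, hg0 x hx, mul_zero, mul_zero, add_zero]
  · rw [hg_mid x hx]
    exact le_add_of_nonneg_left (mul_nonneg (sub_nonneg.2 hε1) (hf.nonneg x))

end InteriorDensity

/-! ### The hypercube of wavelet perturbations -/

theorem integrable_dyadic {g : ℝ → ℝ} (hg : Integrable g) (j k : ℤ) : Integrable (dyadic g j k) :=
  ((hg.comp_sub_right (k : ℝ)).comp_mul_left' (zpow_ne_zero j two_ne_zero)).const_mul _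

theorem integral_dyadic (g : ℝ → ℝ) (j k : ℤ) :
    ∫ x, dyadic g j k x = (2 : ℝ) ^ ((j : ℝ) / 2) * (((2 : ℝ) ^ j)⁻¹ * ∫ y, g y) := by
  simp only [dyadic]
  rw [integral_const_mul, integral_comp_dyadic g]

section BoundedSupport

variable {g : ℝ → ℝ} {B R r : ℝ}

/-- `g` is a measurable function bounded by `B` that vanishes outside `[-R, R]`. -/
structure IsBoundedSupported (g : ℝ → ℝ) (B R : ℝ) : Prop where
  measurable : Measurable g
  abs_le : ∀ x, |g x| ≤ B
  eq_zero : ∀ x, R < |x| → g x = 0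

theorem IsBoundedSupported.nonneg (hg : IsBoundedSupported g B R) : 0 ≤ B :=
  (abs_nonneg _).trans (hg.abs_le 0)

theorem IsBoundedSupported.memLp_top (hg : IsBoundedSupported g B R) : MemLp g ⊤ volume :=
  memLp_top_of_bound hg.measurable.aestronglyMeasurable B (.of_forall hg.abs_le)

theorem IsBoundedSupported.integrable (hg : IsBoundedSupported g B R) : Integrable g := by
  have hsupp : Function.support g ⊆ Set.Icc (-R) R := fun x hx => by
    rw [Set.mem_Icc, ← _root_.abs_le]
    exact not_lt.1 fun h => hx (hg.eq_zero x h)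
  rw [← integrableOn_iff_integrable_of_support_subset hsupp]
  exact Measure.integrableOn_of_bounded measure_Icc_lt_top.ne
    hg.measurable.aestronglyMeasurable (.of_forall hg.abs_le)

theorem IsBoundedSupported.abs_rpow (hg : IsBoundedSupported g B R) (hr : 0 < r) :
    IsBoundedSupported (fun x => |g x| ^ r) (B ^ r) R where
  measurable := hg.measurable.abs.pow_const r
  abs_le x := by
    rw [abs_of_nonneg (by positivity)]
    exact Real.rpow_le_rpow (abs_nonneg _) (hg.abs_le x) hr.le
  eq_zero x hx := by rw [hg.eq_zero x hx, abs_zero, Real.zero_rpow hr.ne']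

end BoundedSupport

section Perturbation

variable {φ ψ b : ℝ → ℝ} {R m n : ℕ} {B γ α r s L T c₀ c₁ : ℝ} {p q : ℝ≥0∞}
  {j : ℤ} {i l : Fin m} {x : ℝ}

/-- Shifts for which wavelets supported in `[-R, R]` have disjoint supports. -/
def spacedShift (R : ℕ) (i : Fin m) : ℤ := 3 * R * (i : ℕ)

theorem spacedShift_injective (hR : 1 ≤ R) : Function.Injective (spacedShift R : Fin m → ℤ) := by
  intro i l h
  have hR' : (3 * R : ℤ) ≠ 0 := by positivity
  exact Fin.ext (Int.natCast_inj.1 (mul_left_cancel₀ hR' h))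

theorem le_abs_spacedShift_sub (R : ℕ) (h : i ≠ l) :
    (3 * R : ℝ) ≤ |(spacedShift R i : ℝ) - spacedShift R l| := by
  have hil : (1 : ℝ) ≤ |((i : ℕ) : ℝ) - ((l : ℕ) : ℝ)| := by
    exact_mod_cast Int.one_le_abs (sub_ne_zero.2 fun h' => h (Fin.ext (Int.natCast_inj.1 h')))
  simp only [spacedShift]
  push_cast
  rw [← mul_sub, abs_mul, abs_of_nonneg (by positivity)]
  exact le_mul_of_one_le_right (by positivity) hil

/-- The interval carrying the wavelet of level `j` and shift `spacedShift R i`. -/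
def cell (R : ℕ) (j : ℤ) (i : Fin m) : Set ℝ :=
  {x | |(2 : ℝ) ^ j * x - spacedShift R i| ≤ R}

theorem measurableSet_cell (R : ℕ) (j : ℤ) (i : Fin m) : MeasurableSet (cell R j i) :=
  (isClosed_le (by fun_prop) continuous_const).measurableSet

theorem disjoint_cell (hR : 1 ≤ R) (h : i ≠ l) : Disjoint (cell R j i) (cell R j l) := by
  refine Set.disjoint_left.2 fun x hi hl => ?_
  have hR' : (1 : ℝ) ≤ R := by exact_mod_cast hR
  have hi' : |(spacedShift R i : ℝ) - (2 : ℝ) ^ j * x| ≤ R := (abs_sub_comm _ _).trans_le hi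
  have hl' : |(2 : ℝ) ^ j * x - spacedShift R l| ≤ R := hl
  linarith [le_abs_spacedShift_sub R h,
    abs_sub_le (spacedShift R i : ℝ) ((2 : ℝ) ^ j * x) (spacedShift R l)]

theorem dyadic_eq_zero_of_notMem_cell (hψ : ∀ x : ℝ, R < |x| → ψ x = 0) (hx : x ∉ cell R j i) :
    dyadic ψ j (spacedShift R i) x = 0 := by
  rw [dyadic, hψ _ (not_le.1 hx), mul_zero]

/-- The sum of the wavelets of level `j` with shifts `spacedShift R i`, scaled by `γ` and with the
signs encoded by `σ`. -/
def perturbation (ψ : ℝ → ℝ) (R : ℕ) (j : ℤ) (γ : ℝ) (σ : Fin m → Bool) (x : ℝ) : ℝ :=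
  ∑ i, γ * bitSign (σ i) * dyadic ψ j (spacedShift R i) x

theorem perturbation_of_mem_cell (hψ : ∀ x : ℝ, R < |x| → ψ x = 0) (hR : 1 ≤ R) (γ : ℝ)
    (σ : Fin m → Bool) (hx : x ∈ cell R j i) :
    perturbation ψ R j γ σ x = γ * bitSign (σ i) * dyadic ψ j (spacedShift R i) x := by
  refine Finset.sum_eq_single i (fun l _ hl => ?_) fun h => absurd (Finset.mem_univ i) h
  have hx' : x ∉ cell R j l := Set.disjoint_left.1 (disjoint_cell hR hl.symm) hx
  rw [dyadic_eq_zero_of_notMem_cell hψ hx', mul_zero]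

theorem perturbation_of_notMem_cell (hψ : ∀ x : ℝ, R < |x| → ψ x = 0) (γ : ℝ)
    (σ : Fin m → Bool) (hx : ∀ i : Fin m, x ∉ cell R j i) : perturbation ψ R j γ σ x = 0 :=
  Finset.sum_eq_zero fun i _ => by rw [dyadic_eq_zero_of_notMem_cell hψ (hx i), mul_zero]

theorem abs_mul_bitSign (hγ : 0 ≤ γ) (a : Bool) : |γ * bitSign a| = γ := by
  rw [abs_mul, abs_bitSign, mul_one, abs_of_nonneg hγ]

theorem integrable_perturbation (hψ : Integrable ψ) (R : ℕ) (j : ℤ) (γ : ℝ) (σ : Fin m → Bool) :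
    Integrable (perturbation ψ R j γ σ) :=
  integrable_finsetSum _ fun _ _ => (integrable_dyadic hψ _ _).const_mul _

theorem integral_perturbation (hψ : Integrable ψ) (hψ0 : ∫ y, ψ y = 0) (R : ℕ) (j : ℤ) (γ : ℝ)
    (σ : Fin m → Bool) : ∫ x, perturbation ψ R j γ σ x = 0 := by
  simp only [perturbation]
  rw [integral_finsetSum _ fun i _ => (integrable_dyadic hψ _ _).const_mul _]
  refine Finset.sum_eq_zero fun i _ => ?_
  rw [integral_const_mul, integral_dyadic, hψ0, mul_zero, mul_zero, mul_zero]

theorem perturbation_sub_perturbation_flipAt (ψ : ℝ → ℝ) (R : ℕ) (j : ℤ) (γ : ℝ)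
    (σ : Fin m → Bool) (i : Fin m) (x : ℝ) :
    perturbation ψ R j γ σ x - perturbation ψ R j γ (flipAt i σ) x =
      2 * (γ * bitSign (σ i)) * dyadic ψ j (spacedShift R i) x := by
  have hflip : bitSign (!σ i) = -bitSign (σ i) := by
    cases σ i <;> simp [bitSign]
  simp only [perturbation]
  rw [← Finset.sum_sub_distrib, Finset.sum_eq_single i]
  · rw [flipAt_self, hflip]
    ring
  · intro l _ hl
    rw [flipAt_of_ne hl, sub_self]
  · exact fun h => absurd (Finset.mem_univ i) h

theorem integral_abs_perturbation_sub_flipAt (ψ : ℝ → ℝ) (R : ℕ) (j : ℤ) (hγ : 0 ≤ γ)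
    (σ : Fin m → Bool) (i : Fin m) :
    ∫ x, |perturbation ψ R j γ σ x - perturbation ψ R j γ (flipAt i σ) x| =
      2 * γ * ((2 : ℝ) ^ ((j : ℝ) / 2) * (((2 : ℝ) ^ j)⁻¹ * ∫ y, |ψ y|)) := by
  rw [← integral_dyadic _ _ (spacedShift R i), ← integral_const_mul]
  refine integral_congr_ae (.of_forall fun x => ?_)
  simp only [perturbation_sub_perturbation_flipAt, dyadic]
  rw [abs_mul, abs_mul, abs_mul_bitSign hγ, abs_mul, abs_two, abs_of_nonneg (by positivity)]

theorem setLIntegral_cell_abs_rpow (hψ : IsBoundedSupported ψ B R) (hγ : 0 ≤ γ) (hr : 0 < r)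
    (j : ℤ) (i : Fin m) :
    ∫⁻ x in cell R j i, ENNReal.ofReal (|γ * dyadic ψ j (spacedShift R i) x| ^ r) =
      ENNReal.ofReal ((γ * (2 : ℝ) ^ ((j : ℝ) / 2)) ^ r * (((2 : ℝ) ^ j)⁻¹ * ∫ y, |ψ y| ^ r)) := by
  set G : ℝ → ℝ := fun y => |ψ y| ^ r
  have hG : Integrable G := (hψ.abs_rpow hr).integrable
  set k := spacedShift R i with hk
  have hpow : ∀ x, |γ * dyadic ψ j k x| ^ r =
      (γ * (2 : ℝ) ^ ((j : ℝ) / 2)) ^ r * G ((2 : ℝ) ^ j * x - k) := by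
    intro x
    rw [dyadic, ← mul_assoc, abs_mul, abs_of_nonneg (by positivity),
      Real.mul_rpow (by positivity) (abs_nonneg _)]
  have hint : Integrable fun x => |γ * dyadic ψ j k x| ^ r := by
    simp only [hpow]
    exact ((hG.comp_sub_right (k : ℝ)).comp_mul_left' (zpow_ne_zero j two_ne_zero)).const_mul _
  have hoff : ∀ x ∉ cell R j i, |γ * dyadic ψ j k x| ^ r = 0 := by
    intro x hx
    rw [hk, dyadic_eq_zero_of_notMem_cell hψ.eq_zero hx, mul_zero, abs_zero, Real.zero_rpow hr.ne']
  rw [← ofReal_integral_eq_lintegral_ofReal hint.integrableOn (.of_forall fun x => by positivity),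
    setIntegral_eq_integral_of_forall_compl_eq_zero hoff]
  simp only [hpow]
  rw [integral_const_mul, integral_comp_dyadic]

/-- The perturbations of level `j` and amplitude `γ` preserve the positivity of a base density that
is at least `c₀` on `[-T/2, T/2]`, and their Besov norm is at most `c₁`. -/
structure IsAdmissible (s : ℝ) (p : ℝ≥0∞) (B T c₀ c₁ : ℝ) (R m j : ℕ) (γ : ℝ) : Prop where
  nonneg : 0 ≤ γ
  sup_le : γ * ((2 : ℝ) ^ (((j : ℤ) : ℝ) / 2) * B) ≤ c₀
  abs_le_of_mem_cell : ∀ i : Fin m, ∀ x ∈ cell R j i, |x| ≤ T / 2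
  besov_le : ENNReal.ofReal ((2 : ℝ) ^ ((j : ℝ) * (s + 1 / 2 - p.toReal⁻¹)) * γ) *
    (m : ℝ≥0∞) ^ p.toReal⁻¹ ≤ ENNReal.ofReal c₁

variable {hφ2 : MemLp φ 2 volume} {hψ2 : MemLp ψ 2 volume} {J : ℕ}

theorem IsAdmissible.isDensity_add (hγ : IsAdmissible s p B T c₀ c₁ R m J γ)
    (hb : IsInteriorDensity φ ψ s p q L T c₀ c₁ b) (hψ : IsBoundedSupported ψ B R)
    (hψ0 : ∫ y, ψ y = 0) (hR : 1 ≤ R) (σ : Fin m → Bool) :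
    IsDensity fun x => b x + perturbation ψ R J γ σ x where
  integrable := hb.isDensity.integrable.add (integrable_perturbation hψ.integrable _ _ _ _)
  nonneg x := by
    by_cases hx : ∃ i : Fin m, x ∈ cell R J i
    · obtain ⟨i, hi⟩ := hx
      have habs : |γ * bitSign (σ i) * dyadic ψ J (spacedShift R i) x| ≤ b x := by
        rw [abs_mul, abs_mul_bitSign hγ.nonneg, dyadic, abs_mul, abs_of_nonneg (by positivity)]
        refine le_trans ?_ (hγ.sup_le.trans (hb.le x (hγ.abs_le_of_mem_cell i x hi)))
        have := hγ.nonneg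
        gcongr
        exact hψ.abs_le _
      rw [perturbation_of_mem_cell hψ.eq_zero hR γ σ hi]
      linarith [neg_abs_le (γ * bitSign (σ i) * dyadic ψ J (spacedShift R i) x)]
    · rw [perturbation_of_notMem_cell hψ.eq_zero γ σ (not_exists.1 hx), add_zero]
      exact hb.isDensity.nonneg x
  integral_eq_one := by
    rw [integral_add hb.isDensity.integrable (integrable_perturbation hψ.integrable _ _ _ _),
      integral_perturbation hψ.integrable hψ0, hb.isDensity.integral_eq_one, add_zero]

theorem IsAdmissible.add_mem_densityBesov (hγ : IsAdmissible s p B T c₀ c₁ R m J γ)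
    (h : IsWaveletPair φ ψ hφ2 hψ2) (hp : 1 ≤ p) (hq : 1 ≤ q) (hφ : MemLp φ ⊤ volume)
    (hb : IsInteriorDensity φ ψ s p q L T c₀ c₁ b) (hψ : IsBoundedSupported ψ B R)
    (hψ0 : ∫ y, ψ y = 0) (hR : 1 ≤ R) (hT : 0 < T) (σ : Fin m → Bool) :
    (fun x => b x + perturbation ψ R J γ σ x) ∈ densityBesov φ ψ s p q L T := by
  refine mem_densityBesov_of_isDensity (hγ.isDensity_add hb hψ hψ0 hR σ) (fun x hx => ?_) ?_
  · have hcell : ∀ i : Fin m, x ∉ cell R J i := fun i hi => by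
      linarith [hγ.abs_le_of_mem_cell i x hi]
    rw [hb.eq_zero x hx, perturbation_of_notMem_cell hψ.eq_zero γ σ hcell, add_zero]
  · have hpert : besovNorm φ ψ s p q (perturbation ψ R J γ σ) ≤ ENNReal.ofReal c₁ := by
      refine (h.besovNorm_sum_dyadic_le hq hγ.nonneg (fun i => (abs_mul_bitSign hγ.nonneg _).le)
        (spacedShift_injective hR) s p J).trans ?_
      rw [Fintype.card_fin]
      exact hγ.besov_le
    exact (besovNorm_add_le hp hq hφ hψ.memLp_top hb.isDensity.integrable
      (integrable_perturbation hψ.integrable _ _ _ _)).trans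
        ((add_le_add_right hpert _).trans hb.besovNorm_add_le)

theorem IsAdmissible.isHypercube (hγ : IsAdmissible s p B T c₀ c₁ R m J γ)
    (hb : IsInteriorDensity φ ψ s p q L T c₀ c₁ b) (hψ : IsBoundedSupported ψ B R)
    (hψ0 : ∫ y, ψ y = 0) (hR : 1 ≤ R) :
    IsHypercube (fun (σ : Fin m → Bool) x => b x + perturbation ψ R J γ σ x) b
      (fun i x => γ * dyadic ψ J (spacedShift R i) x) (cell R J) where
  isDensity := hγ.isDensity_add hb hψ hψ0 hR
  measurable_base := hb.measurable
  measurable_bump i := by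
    have := hψ.measurable
    unfold dyadic
    fun_prop
  measurableSet_cell := measurableSet_cell R J
  disjoint_cells _ _ := disjoint_cell hR
  eq_on_cell σ i x hx := by
    rw [perturbation_of_mem_cell hψ.eq_zero hR γ σ hx]
    ring

theorem IsAdmissible.le_privateMinimaxRisk (hγ : IsAdmissible s p B T c₀ c₁ R m J γ)
    (h : IsWaveletPair φ ψ hφ2 hψ2) (hp : 1 ≤ p) (hq : 1 ≤ q) (hφ : MemLp φ ⊤ volume)
    (hb : IsInteriorDensity φ ψ s p q L T c₀ c₁ b) (hψ : IsBoundedSupported ψ B R)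
    (hψ0 : ∫ y, ψ y = 0) (hR : 1 ≤ R) (hT : 0 < T) (hα : 0 ≤ α) (hr : 0 < r) {δ : ℝ≥0}
    (hδ : (Real.exp α - 1) * (2 * γ * ((2 : ℝ) ^ (((J : ℤ) : ℝ) / 2) *
      (((2 : ℝ) ^ (J : ℤ))⁻¹ * ∫ y, |ψ y|))) ≤ δ)
    (hδn : (1 + (δ : ℝ≥0∞) ^ 2) ^ n ≤ 2) :
    m * ENNReal.ofReal ((γ * (2 : ℝ) ^ (((J : ℤ) : ℝ) / 2)) ^ r *
      (((2 : ℝ) ^ (J : ℤ))⁻¹ * ∫ y, |ψ y| ^ r)) / 4 ≤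
      privateMinimaxRisk.{u} α n r (densityBesov φ ψ s p q L T) := by
  have hdist : ∀ (σ : Fin m → Bool) i,
      (Real.exp α - 1) * (∫ x, |(b x + perturbation ψ R J γ σ x) -
        (b x + perturbation ψ R J γ (flipAt i σ) x)|) ≤ δ := by
    simpa only [add_sub_add_left_eq_sub,
      integral_abs_perturbation_sub_flipAt _ _ _ hγ.nonneg] using fun _ _ => hδ
  have hrisk := (hγ.isHypercube hb hψ hψ0 hR).le_privateMinimaxRisk
    (hγ.add_mem_densityBesov h hp hq hφ hb hψ hψ0 hR hT) hα hr.le hdist hδn ENNReal.ofReal_ne_top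
    fun i => (setLIntegral_cell_abs_rpow hψ hγ.nonneg hr J i).ge
  rwa [Fintype.card_fin] at hrisk

end Perturbation

/-! ### The choice of the level -/

theorem one_add_sq_pow_le_two {δ : ℝ≥0} {n : ℕ} (h : n * (δ : ℝ) ^ 2 ≤ 1 / 4) :
    (1 + (δ : ℝ≥0∞) ^ 2) ^ n ≤ 2 := by
  have hreal : (1 + (δ : ℝ) ^ 2) ^ n ≤ 2 := by
    calc (1 + (δ : ℝ) ^ 2) ^ n ≤ Real.exp ((δ : ℝ) ^ 2) ^ n := by
          gcongr
          linarith [Real.add_one_le_exp ((δ : ℝ) ^ 2)]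
      _ = Real.exp (n * (δ : ℝ) ^ 2) := by rw [← Real.exp_nat_mul]
      _ ≤ Real.exp (Real.log 2) := Real.exp_le_exp.2 (by linarith [Real.log_two_gt_d9])
      _ = 2 := Real.exp_log two_pos
  exact_mod_cast hreal

theorem exists_two_pow_near_rpow {s r E : ℝ} (hs : 0 ≤ s) (hr : 0 ≤ r) (hE : 1 ≤ E) :
    ∃ i : ℕ, E ≤ ((2 : ℝ) ^ i) ^ (2 * s + 2) ∧
      2 ^ (-(s * r)) * E ^ (-(r * s / (2 * s + 2))) ≤ ((2 : ℝ) ^ i) ^ (-(s * r)) := by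
  have hE0 : 0 ≤ E := zero_le_one.trans hE
  set y := E ^ (1 / (2 * s + 2)) with hy
  have hy1 : 1 ≤ y := Real.one_le_rpow hE (by positivity)
  have hyE : y ^ (2 * s + 2) = E := by
    rw [hy, ← Real.rpow_mul hE0, one_div_mul_cancel (by positivity), Real.rpow_one]
  have hyr : E ^ (-(r * s / (2 * s + 2))) = y ^ (-(s * r)) := by
    rw [hy, ← Real.rpow_mul hE0]
    congr 1
    field_simp
  obtain ⟨i, hi, hi'⟩ := exists_nat_pow_near hy1 one_lt_two
  refine ⟨i + 1, hyE ▸ Real.rpow_le_rpow (by positivity) hi'.le (by positivity), ?_⟩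
  rw [hyr, ← Real.mul_rpow zero_le_two (by positivity)]
  refine Real.rpow_le_rpow_of_nonpos (by positivity) ?_ (neg_nonpos.2 (by positivity))
  rw [pow_succ']
  exact mul_le_mul_of_nonneg_left hi zero_le_two

section Level

variable {φ ψ b : ℝ → ℝ} {hφ2 : MemLp φ 2 volume} {hψ2 : MemLp ψ 2 volume} {N R m n i j J : ℕ}
  {A B W c r s L T x c₀ c₁ : ℝ} {p q : ℝ≥0∞}

/-- The coefficient for which wavelets of level `j` have sup norm of order `c 2^{-js}`, as in a
Hölder ball of smoothness `s`. -/
def amplitude (c s : ℝ) (j : ℕ) : ℝ := c * ((2 : ℝ) ^ j) ^ (-(s + 1 / 2))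

theorem amplitude_nonneg (hc : 0 ≤ c) (s : ℝ) (j : ℕ) : 0 ≤ amplitude c s j :=
  mul_nonneg hc (by positivity)

theorem amplitude_mul_two_rpow_half (c s : ℝ) (j : ℕ) :
    amplitude c s j * (2 : ℝ) ^ (((j : ℤ) : ℝ) / 2) = c * ((2 : ℝ) ^ j) ^ (-s) := by
  have hhalf : (2 : ℝ) ^ (((j : ℤ) : ℝ) / 2) = ((2 : ℝ) ^ j) ^ (1 / 2 : ℝ) := by
    rw [← Real.rpow_natCast, ← Real.rpow_mul zero_le_two, Int.cast_natCast, mul_one_div]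
  rw [amplitude, hhalf, mul_assoc, ← Real.rpow_add (by positivity), neg_add, neg_add_cancel_right]

theorem abs_le_half_of_mem_cell (hJ : 6 * R ≤ (2 : ℝ) ^ J * T) (l : Fin (2 ^ i))
    (hx : x ∈ cell R ((i + J : ℕ) : ℤ) l) : |x| ≤ T / 2 := by
  have hl : ((l : ℕ) : ℝ) + 1 ≤ (2 : ℝ) ^ i := by exact_mod_cast l.2
  have hshift : |(spacedShift R l : ℝ)| = 3 * R * l := by
    rw [spacedShift]
    push_cast
    exact abs_of_nonneg (by positivity)
  have hx' : (2 : ℝ) ^ i * ((2 : ℝ) ^ J * |x|) ≤ (2 : ℝ) ^ i * (3 * R) := by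
    calc (2 : ℝ) ^ i * ((2 : ℝ) ^ J * |x|) = |(2 : ℝ) ^ ((i + J : ℕ) : ℤ) * x| := by
          rw [zpow_natCast, abs_mul, abs_pow, abs_two, pow_add, mul_assoc]
      _ ≤ R + |(spacedShift R l : ℝ)| := by
          linarith [abs_sub_abs_le_abs_sub ((2 : ℝ) ^ ((i + J : ℕ) : ℤ) * x) (spacedShift R l : ℝ),
            show |(2 : ℝ) ^ ((i + J : ℕ) : ℤ) * x - spacedShift R l| ≤ R from hx]
      _ ≤ 3 * R * (l + 1) := by
          rw [hshift]
          linarith [(Nat.cast_nonneg R : (0 : ℝ) ≤ R)]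
      _ ≤ (2 : ℝ) ^ i * (3 * R) := by
          rw [mul_comm]
          gcongr
  have hxJ := le_of_mul_le_mul_left hx' (by positivity)
  refine le_of_mul_le_mul_left (a := (2 : ℝ) ^ J) ?_ (by positivity)
  linarith

theorem ofReal_amplitude_mul_card_rpow_le (hc : 0 ≤ c) (s : ℝ) {t : ℝ} (ht : 0 ≤ t) (hij : i ≤ j) :
    ENNReal.ofReal ((2 : ℝ) ^ ((j : ℝ) * (s + 1 / 2 - t)) * amplitude c s j) *
      ((2 ^ i : ℕ) : ℝ≥0∞) ^ t ≤ ENNReal.ofReal c := by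
  set D : ℝ := 2 ^ j with hD
  have hD0 : 0 < D := by positivity
  have hcard : ((2 ^ i : ℕ) : ℝ≥0∞) ^ t ≤ ENNReal.ofReal (D ^ t) := by
    rw [← ENNReal.ofReal_rpow_of_nonneg hD0.le ht, ← ENNReal.ofReal_natCast]
    gcongr
    push_cast
    exact pow_le_pow_right₀ one_le_two hij
  have hlevel : (2 : ℝ) ^ ((j : ℝ) * (s + 1 / 2 - t)) = D ^ (s + 1 / 2 - t) := by
    rw [hD, ← Real.rpow_natCast, ← Real.rpow_mul zero_le_two]
  have hcancel : D ^ (s + 1 / 2 - t) * (c * D ^ (-(s + 1 / 2))) * D ^ t = c := by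
    rw [mul_left_comm, ← Real.rpow_add hD0, mul_assoc, ← Real.rpow_add hD0,
      show s + 1 / 2 - t + -(s + 1 / 2) + t = 0 by ring, Real.rpow_zero, mul_one]
  refine (mul_le_mul_right hcard _).trans_eq ?_
  rw [hlevel, ← ENNReal.ofReal_mul (mul_nonneg (by positivity) (amplitude_nonneg hc s j)),
    amplitude, hcancel]

theorem isAdmissible_amplitude (hs : 0 ≤ s) (hc : 0 ≤ c) (hB : 0 ≤ B) (hcB : c * B ≤ c₀)
    (hc₁ : c ≤ c₁) (hJ : 6 * R ≤ (2 : ℝ) ^ J * T) (p : ℝ≥0∞) (i : ℕ) :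
    IsAdmissible s p B T c₀ c₁ R (2 ^ i) (i + J) (amplitude c s (i + J)) where
  nonneg := amplitude_nonneg hc s _
  sup_le := by
    have hdecay : ((2 : ℝ) ^ (i + J)) ^ (-s) ≤ 1 :=
      Real.rpow_le_one_of_one_le_of_nonpos (one_le_pow₀ one_le_two) (neg_nonpos.2 hs)
    rw [← mul_assoc, amplitude_mul_two_rpow_half, mul_right_comm]
    exact (mul_le_of_le_one_right (mul_nonneg hc hB) hdecay).trans hcB
  abs_le_of_mem_cell l _ := abs_le_half_of_mem_cell hJ l
  besov_le := (ofReal_amplitude_mul_card_rpow_le hc s (by positivity) (Nat.le_add_right i J)).trans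
    (ENNReal.ofReal_le_ofReal hc₁)

theorem mul_sq_dist_amplitude_le (hc : 0 ≤ c) (hA : 0 ≤ A) (hcA : c * A ≤ 1 / 4) {e : ℝ}
    (he : n * e ^ 2 ≤ ((2 : ℝ) ^ j) ^ (2 * s + 2)) :
    n * (e * (2 * amplitude c s j * ((2 : ℝ) ^ (((j : ℤ) : ℝ) / 2) *
      (((2 : ℝ) ^ (j : ℤ))⁻¹ * A)))) ^ 2 ≤ 1 / 4 := by
  set D : ℝ := 2 ^ j with hD
  have hD0 : 0 < D := by positivity
  have hdist : 2 * amplitude c s j * ((2 : ℝ) ^ (((j : ℤ) : ℝ) / 2) *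
      (((2 : ℝ) ^ (j : ℤ))⁻¹ * A)) = 2 * (c * A) * D ^ (-(s + 1)) := by
    rw [neg_add, Real.rpow_add hD0, Real.rpow_neg_one, zpow_natCast, ← hD]
    linear_combination (2 * D⁻¹ * A) * amplitude_mul_two_rpow_half c s j
  have hsq : (D ^ (-(s + 1))) ^ 2 = (D ^ (2 * s + 2))⁻¹ := by
    rw [← Real.rpow_mul_natCast hD0.le, ← Real.rpow_neg hD0.le]
    congr 1
    push_cast
    ring
  have hratio : n * e ^ 2 * (D ^ (2 * s + 2))⁻¹ ≤ 1 := by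
    rw [← div_eq_mul_inv]
    exact div_le_one_of_le₀ he (by positivity)
  calc n * (e * (2 * amplitude c s j * ((2 : ℝ) ^ (((j : ℤ) : ℝ) / 2) *
        (((2 : ℝ) ^ (j : ℤ))⁻¹ * A)))) ^ 2
      = 4 * (c * A) ^ 2 * (n * e ^ 2 * (D ^ (2 * s + 2))⁻¹) := by
        rw [hdist, mul_pow, mul_pow, hsq]
        ring
    _ ≤ 4 * (1 / 4) ^ 2 * 1 := by gcongr
    _ = 1 / 4 := by norm_num

theorem card_mul_amplitude_rpow (hc : 0 ≤ c) (r s W : ℝ) (i J : ℕ) :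
    ((2 ^ i : ℕ) : ℝ) * ((amplitude c s (i + J) * (2 : ℝ) ^ ((((i + J : ℕ) : ℤ) : ℝ) / 2)) ^ r *
      (((2 : ℝ) ^ ((i + J : ℕ) : ℤ))⁻¹ * W)) =
      c ^ r * ((2 : ℝ) ^ J) ^ (-(s * r)) * ((2 : ℝ) ^ J)⁻¹ * W * ((2 : ℝ) ^ i) ^ (-(s * r)) := by
  rw [amplitude_mul_two_rpow_half, Real.mul_rpow hc (by positivity),
    ← Real.rpow_mul (by positivity), neg_mul, zpow_natCast, pow_add,
    Real.mul_rpow (by positivity) (by positivity)]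
  push_cast
  field_simp

theorem exists_pos_mul_le_and_le (hc₀ : 0 < c₀) (hc₁ : 0 < c₁) (hB : 0 ≤ B) (hA : 0 ≤ A) :
    ∃ c, 0 < c ∧ c * B ≤ c₀ ∧ c ≤ c₁ ∧ c * A ≤ 1 / 4 := by
  refine ⟨min (min (c₀ / (B + 1)) c₁) (1 / 4 / (A + 1)), by positivity, ?_, ?_, ?_⟩
  · calc _ ≤ c₀ / (B + 1) * (B + 1) := by
          gcongr
          · exact (min_le_left _ _).trans (min_le_left _ _)
          · exact (lt_add_one B).le
      _ = c₀ := div_mul_cancel₀ _ (by positivity)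
  · exact (min_le_left _ _).trans (min_le_right _ _)
  · calc _ ≤ 1 / 4 / (A + 1) * (A + 1) := by
          gcongr
          · exact min_le_right _ _
          · exact (lt_add_one A).le
      _ = 1 / 4 := div_mul_cancel₀ _ (by positivity)

theorem integral_abs_rpow_pos (hψ : IsBoundedSupported ψ B R) (hψ_ne : ¬ ψ =ᵐ[volume] 0)
    (hr : 0 < r) : 0 < ∫ y, |ψ y| ^ r := by
  refine (integral_nonneg fun y => by positivity).lt_of_ne fun h => hψ_ne ?_
  have hae := (integral_eq_zero_iff_of_nonneg (fun y => by positivity)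
    (hψ.abs_rpow hr).integrable).1 h.symm
  filter_upwards [hae] with y hy
  exact abs_eq_zero.1 ((Real.rpow_eq_zero (abs_nonneg _) hr.ne').1 hy)

theorem IsInteriorDensity.exists_level_bound (hb : IsInteriorDensity φ ψ s p q L T c₀ c₁ b)
    (h : IsWaveletPair φ ψ hφ2 hψ2) (hs : 0 ≤ s) (hp : 1 ≤ p) (hq : 1 ≤ q)
    (hφ : MemLp φ ⊤ volume) (hψ : IsBoundedSupported ψ B R) (hψ_ne : ¬ ψ =ᵐ[volume] 0)
    (hψ0 : ∫ y, ψ y = 0) (hR : 1 ≤ R) (hr : 0 < r) (hT : 0 < T) (hc₀ : 0 < c₀) (hc₁ : 0 < c₁) :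
    ∃ C, 0 < C ∧ ∀ α : ℝ, 0 ≤ α → ∀ n i : ℕ,
      n * (Real.exp α - 1) ^ 2 ≤ ((2 : ℝ) ^ i) ^ (2 * s + 2) →
      ENNReal.ofReal (C * ((2 : ℝ) ^ i) ^ (-(s * r))) ≤
        privateMinimaxRisk.{u} α n r (densityBesov φ ψ s p q L T) := by
  set A := ∫ y, |ψ y|
  have hA : 0 ≤ A := integral_nonneg fun y => abs_nonneg _
  have hW := integral_abs_rpow_pos hψ hψ_ne hr
  obtain ⟨c, hc, hcB, hcc₁, hcA⟩ := exists_pos_mul_le_and_le hc₀ hc₁ hψ.nonneg hA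
  obtain ⟨J, hJ⟩ := pow_unbounded_of_one_lt (6 * R / T) (one_lt_two (α := ℝ))
  refine ⟨c ^ r * ((2 : ℝ) ^ J) ^ (-(s * r)) * ((2 : ℝ) ^ J)⁻¹ * (∫ y, |ψ y| ^ r) / 4,
    by positivity, fun α hα n i hn => ?_⟩
  have hγ := isAdmissible_amplitude hs hc.le hψ.nonneg hcB hcc₁ ((div_lt_iff₀ hT).1 hJ).le p i
  have he : 0 ≤ Real.exp α - 1 := sub_nonneg.2 (Real.one_le_exp hα)
  have hn' : n * (Real.exp α - 1) ^ 2 ≤ ((2 : ℝ) ^ (i + J)) ^ (2 * s + 2) :=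
    hn.trans (Real.rpow_le_rpow (by positivity)
      (pow_le_pow_right₀ one_le_two (Nat.le_add_right i J)) (by positivity))
  have hδ := mul_sq_dist_amplitude_le hc.le hA hcA hn'
  have hδ0 : 0 ≤ (Real.exp α - 1) * (2 * amplitude c s (i + J) *
      ((2 : ℝ) ^ ((((i + J : ℕ) : ℤ) : ℝ) / 2) * (((2 : ℝ) ^ ((i + J : ℕ) : ℤ))⁻¹ * A))) := by
    have := hγ.nonneg
    positivity
  refine le_trans (le_of_eq ?_) (hγ.le_privateMinimaxRisk h hp hq hφ hb hψ hψ0 hR hT hα hr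
    (δ := ⟨_, hδ0⟩) le_rfl (one_add_sq_pow_le_two hδ))
  rw [← ENNReal.ofReal_natCast, ← ENNReal.ofReal_mul (Nat.cast_nonneg _),
    card_mul_amplitude_rpow hc.le, div_mul_eq_mul_div, ENNReal.ofReal_div_of_pos four_pos,
    ENNReal.ofReal_ofNat]

theorem IsWaveletPair.exists_private_lower_bound (h : IsWaveletPair φ ψ hφ2 hψ2) (hs : 0 ≤ s)
    (hsN : s < N + 1) (hp : 1 ≤ p) (hq : 1 ≤ q) (hφ_int : Integrable φ) (hφ : MemLp φ ⊤ volume)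
    (hψ : IsBoundedSupported ψ B R) (hψ_ne : ¬ ψ =ᵐ[volume] 0) (hR : 1 ≤ R)
    (hmom : ∀ l ≤ N, ∫ y, y ^ l * ψ y = 0) (hr : 0 < r) (hL : 0 < L) (hT : 0 < T)
    (hne : ∃ L' < L, (densityBesov φ ψ s p q L' T).Nonempty) :
    ∃ C, 0 < C ∧ ∀ α : ℝ, 0 ≤ α → ∀ n : ℕ, 1 ≤ n * (Real.exp α - 1) ^ 2 →
      ENNReal.ofReal (C * (n * (Real.exp α - 1) ^ 2) ^ (-(r * s / (2 * s + 2)))) ≤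
        privateMinimaxRisk.{u} α n r (densityBesov φ ψ s p q L T) := by
  obtain ⟨b, c₀, c₁, hc₀, hc₁, hb⟩ := exists_isInteriorDensity hp hq hsN hφ_int hφ hψ.integrable
    hψ.memLp_top R.cast_nonneg hψ.eq_zero hmom hL hT hne
  have hψ0 : ∫ y, ψ y = 0 := by
    simpa only [pow_zero, one_mul] using hmom 0 N.zero_le
  obtain ⟨C, hC, hbound⟩ :=
    hb.exists_level_bound.{u} h hs hp hq hφ hψ hψ_ne hψ0 hR hr hT hc₀ hc₁
  refine ⟨C * 2 ^ (-(s * r)), by positivity, fun α hα n hE => ?_⟩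
  obtain ⟨i, hEi, hi⟩ := exists_two_pow_near_rpow hs hr.le hE
  refine le_trans (ENNReal.ofReal_le_ofReal ?_) (hbound α hα n i hEi)
  rw [mul_assoc]
  gcongr

end Level

/-! ### The lower bound -/

section LowerBound

variable {φ ψ : ℝ → ℝ} {hφ : MemLp φ 2 volume} {hψ : MemLp ψ 2 volume} {N : ℕ} {B R : ℝ}

theorem FatherRegular.memLp_top (h : FatherRegular φ N) (hφ : AEStronglyMeasurable φ) :
    MemLp φ ⊤ volume := by
  obtain ⟨Φ, hanti, -, hle, -⟩ := h.decay
  exact memLp_top_of_bound hφ (Φ 0) (.of_forall fun x => (hle x).trans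
    (hanti Set.self_mem_Ici (Set.mem_Ici.2 (abs_nonneg x)) (abs_nonneg x)))

theorem FatherRegular.integrable (h : FatherRegular φ N) (hφ : AEStronglyMeasurable φ) :
    Integrable φ := by
  obtain ⟨Φ, -, -, hle, hint, -⟩ := h.decay
  exact hint.mono' hφ (.of_forall hle)

theorem dyadic_zero_zero (g : ℝ → ℝ) : dyadic g 0 0 = g := by
  funext x
  simp only [dyadic, Int.cast_zero, zero_div, Real.rpow_zero, zpow_zero, one_mul, sub_zero]

theorem IsWaveletPair.not_mother_ae_eq_zero (h : IsWaveletPair φ ψ hφ hψ) :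
    ¬ ψ =ᵐ[volume] 0 := by
  intro h0
  have hnorm := h.integral_mother_mul_mother 0 0 0
  rw [if_pos rfl, dyadic_zero_zero, integral_eq_zero_of_ae] at hnorm
  · exact zero_ne_one hnorm
  · filter_upwards [h0] with x hx
    rw [hx, Pi.zero_apply, mul_zero]

theorem IsWaveletPair.integral_dyadic_mul_self (h : IsWaveletPair φ ψ hφ hψ) (j k : ℤ)
    (hj : 1 ≤ j) : ∫ x, dyadic ψ j k x * ψ x = 0 := by
  have horth := h.integral_mother_mul_mother_of_ne (show j ≠ 0 by lia) k 0
  rwa [dyadic_zero_zero] at horth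

theorem exists_isBoundedSupported_ae_eq (hψ : AEStronglyMeasurable ψ) (hB0 : 0 ≤ B)
    (hB : ∀ᵐ x, |ψ x| ≤ B) (hR : ∀ x, R < |x| → ψ x = 0) :
    ∃ ψ', IsBoundedSupported ψ' B R ∧ ψ =ᵐ[volume] ψ' := by
  have hmem : ∀ x, x ∈ Set.Icc (-R) R ↔ |x| ≤ R := fun x => by rw [Set.mem_Icc, abs_le]
  refine ⟨(Set.Icc (-R) R).indicator fun x => max (-B) (min B (hψ.mk ψ x)), ⟨?_, fun x => ?_,
    fun x hx => Set.indicator_of_notMem ((hmem x).not.2 hx.not_ge) _⟩, ?_⟩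
  · exact (measurable_const.max (measurable_const.min
      hψ.stronglyMeasurable_mk.measurable)).indicator measurableSet_Icc
  · by_cases hx : x ∈ Set.Icc (-R) R
    · rw [Set.indicator_of_mem hx, abs_le]
      exact ⟨le_max_left _ _, max_le (neg_le_self hB0) (min_le_left _ _)⟩
    · rwa [Set.indicator_of_notMem hx, abs_zero]
  · filter_upwards [hψ.ae_eq_mk, hB] with x hx hxB
    by_cases hxR : x ∈ Set.Icc (-R) R
    · rw [Set.indicator_of_mem hxR, ← hx, min_eq_right (abs_le.1 hxB).2,
        max_eq_right (abs_le.1 hxB).1]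
    · rw [Set.indicator_of_notMem hxR, hR x (not_le.1 ((hmem x).not.1 hxR))]

theorem exists_nat_forall_eq_zero (hψ : HasCompactSupport ψ) :
    ∃ R : ℕ, 1 ≤ R ∧ ∀ x : ℝ, R < |x| → ψ x = 0 := by
  obtain ⟨R₀, hR₀⟩ := hψ.isCompact.isBounded.subset_closedBall 0
  refine ⟨⌈R₀⌉₊ + 1, Nat.le_add_left 1 _, fun x hx => ?_⟩
  refine image_eq_zero_of_notMem_tsupport fun hmem => ?_
  have hx' := mem_closedBall_zero_iff.1 (hR₀ hmem)
  rw [Real.norm_eq_abs] at hx'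
  push_cast at hx
  linarith [Nat.le_ceil R₀]

theorem proposition2p1_general (h : IsWaveletPair φ ψ hφ hψ) (hφ_int : Integrable φ)
    (hφ_top : MemLp φ ⊤ volume)
    (hweak : ∃ g : ℝ → ℝ, HasWeakDerivOfOrder (N + 1) φ g ∧
      ∃ B : ℝ≥0, ∀ᵐ x : ℝ, ∑' k : ℤ, ‖g (x - k)‖ₑ ≤ B)
    (hsupp : HasCompactSupport ψ) {s : ℝ} (hs : 0 ≤ s) (hsN : s < N + 1) {p q : ℝ≥0∞}
    (hp : 1 ≤ p) (hq : 1 ≤ q) {r : ℝ} (hr : 0 < r) {L T : ℝ} (hL : 0 < L) (hT : 0 < T)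
    (hne : ∃ L' < L, (densityBesov φ ψ s p q L' T).Nonempty) :
    ∃ C : ℝ, 0 < C ∧ ∀ α : ℝ, 0 ≤ α → ∀ n : ℕ, 1 ≤ n * (Real.exp α - 1) ^ 2 →
      ENNReal.ofReal (C * (n * (Real.exp α - 1) ^ 2) ^ (-(r * s / (2 * s + 2)))) ≤
        privateMinimaxRisk.{u} α n r (densityBesov φ ψ s p q L T) := by
  obtain ⟨g, hg, B₀, hB₀⟩ := hweak
  obtain ⟨K, hK⟩ := h.hasDistribDerivBound hg hB₀
  obtain ⟨R, hR1, hR⟩ := exists_nat_forall_eq_zero hsupp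
  have hψ_loc : LocallyIntegrable ψ := hψ.locallyIntegrable one_le_two
  have hψ_int : Integrable ψ := by
    rw [← integrableOn_iff_integrable_of_support_subset (subset_tsupport ψ)]
    exact hψ_loc.integrableOn_isCompact hsupp
  have hψ_ne := h.not_mother_ae_eq_zero
  obtain ⟨B, hB⟩ := hK.exists_ae_bound hψ_loc R.cast_nonneg hR
  obtain ⟨ψ', hψ', hae⟩ := exists_isBoundedSupported_ae_eq hψ.1 (le_max_right B 0)
    (hB.mono fun x hx => hx.trans (le_max_left B 0)) hR
  have hmom : ∀ l ≤ N, ∫ y, y ^ l * ψ' y = 0 := fun l hl => by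
    rw [← integral_pow_mul_eq_zero hψ_int R.cast_nonneg hR hK h.integral_dyadic_mul_self hψ_ne
      (Nat.lt_succ_of_le hl)]
    refine integral_congr_ae ?_
    filter_upwards [hae] with x hx
    rw [hx]
  have hclass : ∀ L, densityBesov φ ψ s p q L T = densityBesov φ ψ' s p q L T := fun L => by
    rw [densityBesov, densityBesov, besovNorm_congr_ae_wavelet hae]
  simp only [hclass] at hne ⊢
  exact (h.congr_ae (hψ.ae_eq hae) hae).exists_private_lower_bound hs hsN hp hq hφ_int hφ_top hψ'
    (fun h0 => hψ_ne (hae.trans h0)) hR1 hmom hr hL hT hne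

end LowerBound

theorem proposition2p1 (φ ψ : ℝ → ℝ) (hφ : MemLp φ 2 volume) (hψ : MemLp ψ 2 volume)
    (hMRA : GeneratesMRA φ hφ) (hmother : IsMotherWavelet φ ψ hφ hψ)
    (N : ℕ) (hreg : FatherRegular φ N) (hsupp : HasCompactSupport ψ)
    (s : ℝ) (hs : 0 < s) (hsN : s < N + 1)
    (p q : ℝ≥0∞) (hp : 1 ≤ p) (hq : 1 ≤ q) (r : ℝ) (hr : 1 ≤ r)
    (L T : ℝ) (hL : 0 < L) (hT : 0 < T)
    (hne : ∃ L' < L, (densityBesov φ ψ s p q L' T).Nonempty) :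
    ∃ C : ℝ, 0 < C ∧ ∀ α : ℝ, 0 < α → ∀ n : ℕ, 1 ≤ n * (Real.exp α - 1) ^ 2 →
      ENNReal.ofReal (C * (n * (Real.exp α - 1) ^ 2) ^ (-(r * s / (2 * s + 2)))) ≤
        privateMinimaxRisk.{u} α n r (densityBesov φ ψ s p q L T) := by
  obtain ⟨C, hC, hbound⟩ := proposition2p1_general.{u} (hmother.isWaveletPair hMRA)
    (hreg.integrable hφ.1) (hreg.memLp_top hφ.1) hreg.weakDeriv hsupp hs.le hsN hp hq
    (one_pos.trans_le hr) hL hT hne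
  exact ⟨C, hC, fun α hα => hbound α hα.le⟩

end
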